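/- Let $m,r$ be integers with $r\ge 0$, $m\ge r+2$, let $0<\lambda\le 1$, and let $X=\{x_j\}_{j=0}^{m-1}$ be real knots, $x_0\le x_1\le\dots\le x_{m-1}$ (repetitions allowed), with $I=[x_0,x_{m-1}]$, $|I|=x_{m-1}-x_0>0$ and $$x_{j+r+1}-x_j\ge\lambda|I|\qquad(0\le j\le m-r-2).$$ Let $f\in C^{(r)}(I)$, and let $L_{m-1}(\cdot\,;f;X)$ be its Hermite interpolating polynomial $$L_{m-1}(x;f;X)=f(x_0)+\sum_{j=1}^{m-1}[x_0,\dots,x_j;f]\,(x-x_0)\cdots(x-x_{j-1}),$$ where $[x_i,\dots,x_{i+n};f]$ are the divided differences: $[x_i;f]=f(x_i)$ and, for $n\ge1$, $[x_i,\dots,x_{i+n};f]=f^{(n)}(x_i)/n!$ if $x_i=x_{i+n}$, and $[x_i,\dots,x_{i+n};f]=\big([x_{i+1},\dots,x_{i+n};f]-[x_i,\dots,x_{i+n-1};f]\big)/(x_{i+n}-x_i)$ otherwise (derivatives at the endpoints of $I$ are one-sided). This is the polynomial of degree $\le m-1$ such that, for every $0\le j\le m-1$, $L_{m-1}^{(\ell)}(x_j;f;X)=f^{(\ell)}(x_j)$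 with $\ell=\#\{i<j: x_i=x_j\}$. For $x\in I$ let $\sigma$ be any permutation of $(0,\dots,m-1)$ with $|x-x_{\sigma_{\nu-1}}|\le|x-x_{\sigma_\nu}|$ for $1\le\nu\le m-1$, and put $D_r(x,X)=\prod_{\nu=0}^{r}|x-x_{\sigma_\nu}|$. For $g\in C(I)$ and $k\ge1$ let $$\omega_k(g,t,I)=\sup\Big\{\Big|\sum_{i=0}^k(-1)^i\tbinom ki g\big(y+(\tfrac k2-i)u\big)\Big| : 0<u\le t,\ y\pm\tfrac k2u\in I\Big\}$$ (with $\sup\emptyset=0$) be the $k$-th modulus of smoothness. Then there is a constant $C(m,\lambda)$, depending only on $m$ and $\lambda$, such that for all such $r$, $X$, $f$ and each $x\in I$ $$\big|f(x)-L_{m-1}(x;f;X)\big|\le C(m,\lambda)\,D_r(x,X)\int_{|x-x_{\sigma_r}|}^{2|I|}\frac{\omega_{m-r}(f^{(r)},t,I)}{t^2}\,dt .$$ If $x_{\sigma_r}=x$, then $D_r(x,X)=0$ and the right-hand side is read as $0$, even if the integral diverges. -/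

import Mathlib

open Polynomial

noncomputable section

namespace HermiteApprox

/-- The symmetric difference `Δ^k_u(g, x; [a,b])` of order `k` with step `u`, equal to `0` if one of
the points `x ± (k/2) u` is outside `[a,b]`. -/
def centralDiff (k : ℕ) (u : ℝ) (g : ℝ → ℝ) (x a b : ℝ) : ℝ :=
  open Classical in
  if x - (k / 2 : ℝ) * u ∈ Set.Icc a b ∧ x + (k / 2 : ℝ) * u ∈ Set.Icc a b then
    ∑ i ∈ Finset.range (k + 1),
      (-1 : ℝ) ^ i * (k.choose i : ℝ) * g (x + ((k / 2 : ℝ) - (i : ℝ)) * u)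
  else 0

/-- The `k`-th modulus of smoothness `ω_k(g, t; [a,b])`: the supremum over `0 < u ≤ t` of the
uniform norm on `[a,b]` of `Δ^k_u(g, ·; [a,b])`. The set is bounded when `g` is continuous on
`[a,b]`. -/
def modulus (k : ℕ) (g : ℝ → ℝ) (t a b : ℝ) : ℝ :=
  sSup {y : ℝ | ∃ u x : ℝ, 0 < u ∧ u ≤ t ∧ x ∈ Set.Icc a b ∧ y = |centralDiff k u g x a b|}

/-- The Lagrange-Hermite divided difference `[x_i, …, x_{i+n}; f]` of order `n` of a function `f`
on the interval `s`, for knots with `x_i ≤ x_{i+1} ≤ … ≤ x_{i+n}`. As the knots are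
nondecreasing, they all coincide exactly when the first equals the last; otherwise the first and
the last knot are different and serve as the two knots removed in the recursion. -/
def divDiff (f : ℝ → ℝ) (s : Set ℝ) (x : ℕ → ℝ) : ℕ → ℕ → ℝ
  | 0, i => f (x i)
  | n + 1, i =>
    open Classical in
    if x (i + (n + 1)) = x i then
      iteratedDerivWithin (n + 1) f s (x i) / ((n + 1).factorial : ℝ)
    else
      (divDiff f s x n (i + 1) - divDiff f s x n i) / (x (i + (n + 1)) - x i)

/-- The Hermite polynomial `L_{m-1}(·; f; x_0, …, x_{m-1})` with the `m` knots
`x_0 ≤ … ≤ x_{m-1}`, in the form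
`f(x_0) + ∑_{j=1}^{m-1} [x_0, …, x_j; f] (X - x_0) ⋯ (X - x_{j-1})`. -/
def hermitePoly (f : ℝ → ℝ) (s : Set ℝ) (x : ℕ → ℝ) (m : ℕ) : ℝ[X] :=
  ∑ j ∈ Finset.range m, C (divDiff f s x j 0) * ∏ i ∈ Finset.range j, (X - C (x i))

/-- The number of `i < j` with `x_i = x_j`. -/
def knotOrder (x : ℕ → ℝ) (j : ℕ) : ℕ :=
  open Classical in ((Finset.range j).filter fun i => x i = x j).card

/-- `P` has degree at most `m - 1` and interpolates `f` at the knots `x_0, …, x_{m-1}` in the sense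
of Hermite: at each knot `x_j` the derivatives of order `#{i < j : x_i = x_j}` of `P` and of `f`
agree. -/
def IsHermiteInterpolant (P : ℝ[X]) (f : ℝ → ℝ) (s : Set ℝ) (x : ℕ → ℝ) (m : ℕ) : Prop :=
  P.degree < m ∧ ∀ j < m,
    (derivative^[knotOrder x j] P).eval (x j) = iteratedDerivWithin (knotOrder x j) f s (x j)

/-- `σ` is a permutation of `{0, …, m-1}` that puts the knots `x_0, …, x_{m-1}` in order of
nondecreasing distance from `t`. -/
def IsDistanceOrder (σ : ℕ → ℕ) (x : ℕ → ℝ) (m : ℕ) (t : ℝ) : Prop :=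
  Set.BijOn σ (Set.Iio m) (Set.Iio m) ∧
    ∀ ν : ℕ, ν + 1 < m → |t - x (σ ν)| ≤ |t - x (σ (ν + 1))|

/-- The product `D_r(t, X)` of the distances from `t` to the `r + 1` knots that come first in the
order `σ`. -/
def distProd (σ : ℕ → ℕ) (x : ℕ → ℝ) (r : ℕ) (t : ℝ) : ℝ :=
  ∏ ν ∈ Finset.range (r + 1), |t - x (σ ν)|

end HermiteApprox

end

namespace HermiteApprox

section

/-- The node polynomial `∏ (X - x_l)` of the block of `n` knots starting at index `i`. -/
noncomputable def blockNodal (x : ℕ → ℝ) (n i : ℕ) : ℝ[X] :=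
  ∏ l ∈ Finset.range n, (X - C (x (i + l)))

/-- The Newton form of the Hermite polynomial for the block of `n` knots starting at index `i`. -/
noncomputable def newtonPoly (f : ℝ → ℝ) (s : Set ℝ) (x : ℕ → ℝ) (n i : ℕ) : ℝ[X] :=
  ∑ j ∈ Finset.range n, C (divDiff f s x j i) * blockNodal x j i

/-- The multiset of knots of the block of `n` knots starting at index `i`. -/
def blockKnots (x : ℕ → ℝ) (n i : ℕ) : Multiset ℝ :=
  (Multiset.range n).map fun l => x (i + l)

variable {f : ℝ → ℝ} {s : Set ℝ} {x : ℕ → ℝ} {m n i : ℕ}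

theorem hermitePoly_eq_newtonPoly (f : ℝ → ℝ) (s : Set ℝ) (x : ℕ → ℝ) (m : ℕ) :
    hermitePoly f s x m = newtonPoly f s x m 0 := by
  simp [hermitePoly, newtonPoly, blockNodal]

theorem newtonPoly_succ :
    newtonPoly f s x (n + 1) i = newtonPoly f s x n i + C (divDiff f s x n i) * blockNodal x n i := by
  simp [newtonPoly, Finset.sum_range_succ]

theorem blockNodal_succ : blockNodal x (n + 1) i = blockNodal x n i * (X - C (x (i + n))) := by
  simp [blockNodal, Finset.prod_range_succ]

theorem blockNodal_succ' : blockNodal x (n + 1) i = (X - C (x i)) * blockNodal x n (i + 1) := by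
  simp only [blockNodal, Finset.prod_range_succ', add_zero]
  rw [mul_comm]
  congr 1
  exact Finset.prod_congr rfl fun l _ => by rw [add_right_comm, add_assoc]

theorem blockKnots_succ : blockKnots x (n + 1) i = x (i + n) ::ₘ blockKnots x n i := by
  simp [blockKnots, Multiset.range_succ]

theorem blockKnots_succ' : blockKnots x (n + 1) i = x i ::ₘ blockKnots x n (i + 1) := by
  induction n with
  | zero => simp [blockKnots]
  | succ n ih =>
    rw [blockKnots_succ, ih, blockKnots_succ, Multiset.cons_swap]
    congr 3
    ring

@[simp] theorem card_blockKnots : (blockKnots x n i).card = n := by simp [blockKnots]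

theorem mem_blockKnots {p : ℝ} : p ∈ blockKnots x n i ↔ ∃ l < n, x (i + l) = p := by
  simp [blockKnots]

theorem blockNodal_eq_prod : blockNodal x n i = ((blockKnots x n i).map fun a => X - C a).prod := by
  simp [blockNodal, blockKnots, Finset.prod]

theorem eval_blockNodal (t : ℝ) :
    (blockNodal x n i).eval t = ∏ l ∈ Finset.range n, (t - x (i + l)) := by
  simp [blockNodal, eval_prod]

theorem abs_eval_blockNodal (t : ℝ) :
    |(blockNodal x n i).eval t| = ∏ l ∈ Finset.range n, |t - x (i + l)| := by
  rw [eval_blockNodal, Finset.abs_prod]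

theorem monic_blockNodal : (blockNodal x n i).Monic :=
  monic_prod_of_monic _ _ fun _ _ => monic_X_sub_C _

theorem natDegree_blockNodal : (blockNodal x n i).natDegree = n := by
  simp [blockNodal]

theorem degree_blockNodal : (blockNodal x n i).degree = n := by
  rw [degree_eq_natDegree monic_blockNodal.ne_zero, natDegree_blockNodal]

theorem iterate_derivative_natDegree (P : ℝ[X]) :
    derivative^[P.natDegree] P = C (P.natDegree.factorial * P.leadingCoeff) := by
  have h := natDegree_iterate_derivative P P.natDegree
  rw [Nat.sub_self] at h
  rw [eq_C_of_natDegree_le_zero h, coeff_iterate_derivative, zero_add, Nat.descFactorial_self]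
  simp

theorem iterate_derivative_blockNodal_eq_C :
    derivative^[n] (blockNodal x n i) = C (n.factorial : ℝ) := by
  have := iterate_derivative_natDegree (blockNodal x n i)
  rwa [natDegree_blockNodal, monic_blockNodal.leadingCoeff, mul_one] at this

theorem iterate_derivative_blockNodal_eval {p : ℝ} {e : ℕ} (he : e < (blockKnots x n i).count p) :
    (derivative^[e] (blockNodal x n i)).eval p = 0 := by
  apply isRoot_iterate_derivative_of_lt_rootMultiplicity
  rwa [← count_roots, blockNodal_eq_prod, roots_multiset_prod_X_sub_C]

theorem degree_newtonPoly_lt : (newtonPoly f s x n i).degree < n := by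
  induction n with
  | zero => simp [newtonPoly]
  | succ n ih =>
    rw [newtonPoly_succ]
    refine lt_of_le_of_lt (degree_add_le _ _) (max_lt (ih.trans (by exact_mod_cast n.lt_succ_self)) ?_)
    refine lt_of_le_of_lt (degree_mul_le_of_le degree_C_le le_rfl) ?_
    rw [degree_blockNodal, zero_add]
    exact_mod_cast n.lt_succ_self

theorem iterate_derivative_newtonPoly :
    derivative^[n] (newtonPoly f s x (n + 1) i) = C (n.factorial * divDiff f s x n i) := by
  rw [newtonPoly_succ, iterate_map_add, iterate_derivative_C_mul,
    iterate_derivative_eq_zero_of_degree_lt degree_newtonPoly_lt,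
    iterate_derivative_blockNodal_eq_C, zero_add, ← C_mul, mul_comm]

/-- The divided difference of order `n` for a block whose `n + 1` knots coincide. -/
theorem divDiff_of_eq (h : x (i + n) = x i) :
    divDiff f s x n i = iteratedDerivWithin n f s (x i) / (n.factorial : ℝ) := by
  cases n with
  | zero => simp [divDiff]
  | succ n => rw [divDiff, if_pos h]

theorem divDiff_of_ne (h : x (i + (n + 1)) ≠ x i) :
    divDiff f s x (n + 1) i =
      (divDiff f s x n (i + 1) - divDiff f s x n i) / (x (i + (n + 1)) - x i) := by
  rw [divDiff, if_neg h]

/-- The block may equally be extended to the left. -/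
theorem newtonPoly_succ' (hx : MonotoneOn x (Set.Iio m)) (hi : i + n < m) :
    newtonPoly f s x (n + 1) i =
      newtonPoly f s x n (i + 1) + C (divDiff f s x n i) * blockNodal x n (i + 1) := by
  induction n generalizing i with
  | zero => simp [newtonPoly, blockNodal]
  | succ n ih =>
    by_cases h : x (i + (n + 1)) = x i
    · have heq : ∀ l ≤ n + 1, x (i + l) = x i := fun l hl =>
        le_antisymm (h ▸ hx (by simp; omega) (by simpa using hi) (by omega))
          (hx (by simp; omega) (by simp; omega) (by omega))
      have heq' : ∀ l ≤ n, x (i + 1 + l) = x i := fun l hl => by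
        rw [add_assoc]; exact heq _ (by omega)
      have hnod : ∀ j ≤ n + 1, blockNodal x j i = blockNodal x j (i + 1) := fun j hj =>
        Finset.prod_congr rfl fun l hl => by
          rw [Finset.mem_range] at hl
          rw [heq l (by omega), heq' l (by omega)]
      have hdd : ∀ j ≤ n, divDiff f s x j i = divDiff f s x j (i + 1) := fun j hj => by
        have h1 : x (i + 1) = x i := heq 1 (by omega)
        rw [divDiff_of_eq (heq j (by omega)), divDiff_of_eq ((heq' j hj).trans h1.symm), h1]
      rw [newtonPoly_succ, hnod _ le_rfl]
      congr 1
      exact Finset.sum_congr rfl fun j hj => by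
        rw [Finset.mem_range] at hj
        rw [hdd j (by omega), hnod j (by omega)]
    · have h' : x (i + (n + 1)) - x i ≠ 0 := sub_ne_zero.mpr h
      have key : C (divDiff f s x (n + 1) i) * (C (x (i + (n + 1))) - C (x i)) =
          C (divDiff f s x n (i + 1)) - C (divDiff f s x n i) := by
        rw [← C_sub, ← C_mul, ← C_sub, divDiff_of_ne h, div_mul_cancel₀ _ h']
      rw [newtonPoly_succ, ih (by omega), newtonPoly_succ (i := i + 1), blockNodal_succ',
        blockNodal_succ (i := i + 1), show i + 1 + n = i + (n + 1) by ring]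
      linear_combination blockNodal x n (i + 1) * key

/-- Hermite interpolation, counting multiplicities: `newtonPoly` agrees with `f` at each point to
the order of its multiplicity in the block. -/
theorem iterate_derivative_newtonPoly_eval (hx : MonotoneOn x (Set.Iio m)) (hi : i + n ≤ m)
    {p : ℝ} {e : ℕ} (he : e < (blockKnots x n i).count p) :
    (derivative^[e] (newtonPoly f s x n i)).eval p = iteratedDerivWithin e f s p := by
  induction n generalizing i e with
  | zero => simp [blockKnots] at he
  | succ n ih =>
    have left : e < (blockKnots x n i).count p →
        (derivative^[e] (newtonPoly f s x (n + 1) i)).eval p = iteratedDerivWithin e f s p := by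
      intro he'
      rw [newtonPoly_succ, iterate_map_add, iterate_derivative_C_mul, eval_add, eval_C_mul,
        iterate_derivative_blockNodal_eval he', ih (by omega) he', mul_zero, add_zero]
    have right : e < (blockKnots x n (i + 1)).count p →
        (derivative^[e] (newtonPoly f s x (n + 1) i)).eval p = iteratedDerivWithin e f s p := by
      intro he'
      rw [newtonPoly_succ' hx (by omega), iterate_map_add, iterate_derivative_C_mul,
        eval_add, eval_C_mul, iterate_derivative_blockNodal_eval he', ih (by omega) he', mul_zero,
        add_zero]
    by_cases h : p = x (i + n)
    · by_cases h' : p = x i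
      · by_cases hen : e < (blockKnots x n i).count p
        · exact left hen
        · have hall : (blockKnots x n i).count p = n := by
            conv_rhs => rw [← card_blockKnots (x := x) (n := n) (i := i)]
            rw [Multiset.count_eq_card]
            intro a ha
            obtain ⟨l, hl, rfl⟩ := mem_blockKnots.mp ha
            exact le_antisymm (h' ▸ hx (by simp; omega) (by simp; omega) (by omega))
              (h ▸ hx (by simp; omega) (by simp; omega) (by omega))
          rw [blockKnots_succ, ← h, Multiset.count_cons_self] at he
          obtain rfl : e = n := by omega
          have hne : (e.factorial : ℝ) ≠ 0 := by positivity
          rw [iterate_derivative_newtonPoly, eval_C, divDiff_of_eq (h.symm.trans h'), h',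
            mul_div_cancel₀ _ hne]
      · apply right
        rwa [blockKnots_succ', Multiset.count_cons_of_ne h'] at he
    · apply left
      rwa [blockKnots_succ, Multiset.count_cons_of_ne h] at he

/-- Uniqueness of Hermite interpolation. -/
theorem eq_zero_of_iterate_derivative_eval {P : ℝ[X]} {M : Multiset ℝ} (hP : P.degree < M.card)
    (h : ∀ p e, e < M.count p → (derivative^[e] P).eval p = 0) : P = 0 := by
  by_contra hP0
  have hle : M ≤ P.roots := by
    rw [Multiset.le_iff_count]
    intro p
    rw [count_roots]
    rcases Nat.eq_zero_or_pos (M.count p) with h0 | h0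
    · omega
    · have := (lt_rootMultiplicity_iff_isRoot_iterate_derivative (t := p) (n := M.count p - 1)
        hP0).mpr fun e he => h p e (by omega)
      omega
  have h1 := Multiset.card_le_card hle
  have h2 := P.card_roots'
  rw [degree_eq_natDegree hP0] at hP
  have h3 : P.natDegree < M.card := by exact_mod_cast hP
  omega

theorem knotOrder_lt_count {j : ℕ} (hj : j < m) :
    knotOrder x j < (blockKnots x m 0).count (x j) := by
  classical
  have h : (blockKnots x m 0).count (x j) =
      ((Finset.range m).filter fun i => x j = x i).card := by
    simp [blockKnots, Multiset.count_map, Finset.card, Finset.filter]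
  rw [h]
  unfold knotOrder
  apply Finset.card_lt_card
  rw [Finset.ssubset_iff_of_subset]
  · exact ⟨j, by simpa using hj, by simp⟩
  · intro a ha
    simp only [Finset.mem_filter, Finset.mem_range] at ha ⊢
    exact ⟨ha.1.trans hj, ha.2.symm⟩

theorem isHermiteInterpolant_hermitePoly (hx : MonotoneOn x (Set.Iio m)) :
    IsHermiteInterpolant (hermitePoly f s x m) f s x m := by
  rw [hermitePoly_eq_newtonPoly]
  exact ⟨degree_newtonPoly_lt, fun j hj =>
    iterate_derivative_newtonPoly_eval hx (by omega) (knotOrder_lt_count hj)⟩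

end

theorem exists_rolle_list {A B : ℝ} {G₀ G₁ : ℝ → ℝ}
    (hG : ∀ t ∈ Set.Icc A B, HasDerivWithinAt G₀ (G₁ t) (Set.Icc A B) t) (l : List ℝ) :
    ∀ a : ℝ, (a :: l).Pairwise (· ≤ ·) → (∀ p ∈ a :: l, p ∈ Set.Icc A B ∧ G₀ p = 0) →
      ∃ l' : List ℝ, l'.length = l.length ∧ (∀ p ∈ l', a ≤ p ∧ p ∈ Set.Icc A B) ∧
        ∀ p, l'.count p < (a :: l).count p ∨ l'.count p = 0 ∨
          (l'.count p = 1 ∧ p ∉ a :: l ∧ G₁ p = 0) := by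
  induction l with
  | nil => intro a _ _; exact ⟨[], by simp⟩
  | cons b l ih =>
    intro a hs hz
    rw [List.pairwise_cons] at hs
    have hab : a ≤ b := hs.1 b (by simp)
    obtain ⟨l', hlen, hmem, hcount⟩ := ih b hs.2 fun p hp => hz p (List.mem_cons_of_mem _ hp)
    have ha := hz a (by simp)
    have hb := hz b (by simp)
    rcases hab.eq_or_lt with rfl | hab'
    · refine ⟨a :: l', by simp [hlen], ?_, ?_⟩
      · intro p hp
        rcases List.mem_cons.mp hp with rfl | hp
        · exact ⟨le_rfl, ha.1⟩
        · exact hmem p hp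
      · intro p
        by_cases hpa : p = a
        · subst hpa
          left
          rcases hcount p with h | h | h
          · simpa using h
          · simp [h]
          · exact absurd (by simp) h.2.1
        · rw [List.count_cons_of_ne (Ne.symm hpa), List.count_cons_of_ne (Ne.symm hpa)]
          rcases hcount p with h | h | h
          · exact Or.inl h
          · exact Or.inr (Or.inl h)
          · refine Or.inr (Or.inr ⟨h.1, ?_, h.2.2⟩)
            rw [List.mem_cons]
            exact not_or.mpr ⟨hpa, h.2.1⟩
    · have hsub : Set.Icc a b ⊆ Set.Icc A B := Set.Icc_subset_Icc ha.1.1 hb.1.2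
      obtain ⟨w, hw, hw0⟩ := exists_hasDerivAt_eq_zero (f := G₀) (f' := G₁) hab'
        (fun t ht => (hG t (hsub ht)).continuousWithinAt.mono hsub) (ha.2.trans hb.2.symm)
        (fun t ht => (hG t (hsub (Set.Ioo_subset_Icc_self ht))).hasDerivAt
          (Icc_mem_nhds (ha.1.1.trans_lt ht.1) (ht.2.trans_le hb.1.2)))
      refine ⟨w :: l', by simp [hlen], ?_, ?_⟩
      · intro p hp
        rcases List.mem_cons.mp hp with rfl | hp
        · exact ⟨hw.1.le, hsub (Set.Ioo_subset_Icc_self hw)⟩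
        · exact ⟨hab.trans (hmem p hp).1, (hmem p hp).2⟩
      · have hge : ∀ q ∈ b :: l, b ≤ q := by
          intro q hq
          rcases List.mem_cons.mp hq with rfl | hq
          · exact le_rfl
          · exact (List.pairwise_cons.mp hs.2).1 q hq
        intro p
        by_cases hpw : p = w
        · subst hpw
          refine Or.inr (Or.inr ⟨?_, ?_, hw0⟩)
          · rw [List.count_cons_self, List.count_eq_zero_of_not_mem]
            exact fun h => absurd (hmem p h).1 (not_le.mpr hw.2)
          · intro h
            rcases List.mem_cons.mp h with h | h
            · exact hw.1.ne' h
            · exact absurd (hge p h) (not_le.mpr hw.2)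
        · rw [List.count_cons_of_ne (Ne.symm hpw)]
          rcases hcount p with h | h | h
          · exact Or.inl (h.trans_le (List.sublist_cons_self a _ |>.count_le p))
          · exact Or.inr (Or.inl h)
          · refine Or.inr (Or.inr ⟨h.1, ?_, h.2.2⟩)
            rw [List.mem_cons]
            refine not_or.mpr ⟨?_, h.2.1⟩
            have hp : p ∈ l' := List.count_pos_iff.mp (by omega)
            exact (hab'.trans_le (hmem p hp).1).ne'

/-- Rolle's theorem with multiplicities: if a function `G 0` with successive derivatives
`G 1, …, G n` has `n + 1` zeros, counted with multiplicity, then `G n` has a zero. -/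
theorem exists_iterated_rolle {A B : ℝ} {n : ℕ} :
    ∀ {G : ℕ → ℝ → ℝ} {M : Multiset ℝ}, M.card = n + 1 → (∀ p ∈ M, p ∈ Set.Icc A B) →
      (∀ e < n, ∀ t ∈ Set.Icc A B, HasDerivWithinAt (G e) (G (e + 1) t) (Set.Icc A B) t) →
      (∀ p e, e < M.count p → G e p = 0) → ∃ ξ ∈ Set.Icc A B, G n ξ = 0 := by
  induction n with
  | zero =>
    intro G M hM hmem _ hz
    obtain ⟨a, rfl⟩ := Multiset.card_eq_one.mp hM
    exact ⟨a, hmem a (by simp), hz a 0 (by simp)⟩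
  | succ n ih =>
    intro G M hM hmem hG hz
    have hlen : (M.sort (· ≤ ·)).length = n + 2 := by rw [Multiset.length_sort, hM]
    obtain ⟨a, l, hal⟩ := List.exists_cons_of_length_eq_add_one hlen
    have hMl : M = ((a :: l : List ℝ) : Multiset ℝ) := by rw [← hal, Multiset.sort_eq]
    have hsort : (a :: l).Pairwise (· ≤ ·) := hal ▸ Multiset.pairwise_sort M (· ≤ ·)
    rw [hal, List.length_cons] at hlen
    have hcM : ∀ p, M.count p = (a :: l).count p := fun p => by rw [hMl, Multiset.coe_count]
    obtain ⟨l', hl', hmem', hcount⟩ := exists_rolle_list (hG 0 n.succ_pos) l a hsort fun p hp =>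
      ⟨hmem p (by rw [hMl]; exact hp), hz p 0 (by rw [hcM]; exact List.count_pos_iff.mpr hp)⟩
    refine ih (G := fun e => G (e + 1)) (M := (l' : Multiset ℝ)) ?_ ?_ ?_ ?_
    · rw [Multiset.coe_card]; omega
    · exact fun p hp => (hmem' p hp).2
    · exact fun e he t ht => hG (e + 1) (by omega) t ht
    · intro p e he
      rw [Multiset.coe_count] at he
      rcases hcount p with h | h | h
      · exact hz p (e + 1) (by rw [hcM]; omega)
      · omega
      · obtain rfl : e = 0 := by omega
        exact h.2.2

section

variable {f : ℝ → ℝ} {x : ℕ → ℝ} {m n r i : ℕ} {a b A B t : ℝ}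

theorem hasDerivWithinAt_iteratedDerivWithin (hab : a < b)
    (hf : ContDiffOn ℝ r f (Set.Icc a b)) {e : ℕ} (he : e < r) (ht : t ∈ Set.Icc a b) :
    HasDerivWithinAt (iteratedDerivWithin e f (Set.Icc a b))
      (iteratedDerivWithin (e + 1) f (Set.Icc a b) t) (Set.Icc a b) t := by
  rw [iteratedDerivWithin_succ]
  exact (hf.differentiableOn_iteratedDerivWithin (by exact_mod_cast he)
    (uniqueDiffOn_Icc hab) t ht).hasDerivWithinAt

theorem hasDerivWithinAt_sub_polynomial (hab : a < b) (hf : ContDiffOn ℝ r f (Set.Icc a b))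
    (hsub : Set.Icc A B ⊆ Set.Icc a b) (P : ℝ[X]) {e : ℕ} (he : e < r) (ht : t ∈ Set.Icc A B) :
    HasDerivWithinAt
      (fun y => iteratedDerivWithin e f (Set.Icc a b) y - (derivative^[e] P).eval y)
      (iteratedDerivWithin (e + 1) f (Set.Icc a b) t - (derivative^[e + 1] P).eval t)
      (Set.Icc A B) t := by
  rw [Function.iterate_succ_apply']
  exact ((hasDerivWithinAt_iteratedDerivWithin hab hf he (hsub ht)).mono hsub).sub
    ((derivative^[e] P).hasDerivWithinAt t _)

/-- The mean value property of divided differences with possibly coinciding knots. -/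
theorem exists_divDiff_eq (hab : a < b) (hf : ContDiffOn ℝ r f (Set.Icc a b))
    (hx : MonotoneOn x (Set.Iio m)) (hi : i + r < m) (hsub : Set.Icc A B ⊆ Set.Icc a b)
    (hmem : ∀ l < r + 1, x (i + l) ∈ Set.Icc A B) :
    ∃ η ∈ Set.Icc A B, (r.factorial : ℝ) * divDiff f (Set.Icc a b) x r i =
      iteratedDerivWithin r f (Set.Icc a b) η := by
  obtain ⟨η, hη, h0⟩ := exists_iterated_rolle (A := A) (B := B) (n := r)
    (G := fun e y => iteratedDerivWithin e f (Set.Icc a b) y -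
      (derivative^[e] (newtonPoly f (Set.Icc a b) x (r + 1) i)).eval y)
    (M := blockKnots x (r + 1) i) card_blockKnots
    (fun p hp => by obtain ⟨l, hl, rfl⟩ := mem_blockKnots.mp hp; exact hmem l hl)
    (fun e he t ht => hasDerivWithinAt_sub_polynomial hab hf hsub _ he ht)
    (fun p e he => sub_eq_zero.mpr
      (iterate_derivative_newtonPoly_eval hx (by omega) he).symm)
  refine ⟨η, hη, ?_⟩
  rw [iterate_derivative_newtonPoly, eval_C] at h0
  linarith

/-- The error formula of Hermite interpolation at `r` knots. -/
theorem exists_newtonPoly_error_eq (hab : a < b) (hf : ContDiffOn ℝ r f (Set.Icc a b))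
    (hx : MonotoneOn x (Set.Iio m)) (hi : i + r ≤ m) (hsub : Set.Icc A B ⊆ Set.Icc a b)
    (hmem : ∀ l < r, x (i + l) ∈ Set.Icc A B) (ht : t ∈ Set.Icc A B)
    (hne : ∀ l < r, x (i + l) ≠ t) :
    ∃ ξ ∈ Set.Icc A B, (r.factorial : ℝ) * (f t - (newtonPoly f (Set.Icc a b) x r i).eval t) =
      (blockNodal x r i).eval t * iteratedDerivWithin r f (Set.Icc a b) ξ := by
  set N := newtonPoly f (Set.Icc a b) x r i with hN
  have hw : (blockNodal x r i).eval t ≠ 0 := by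
    rw [eval_blockNodal, Finset.prod_ne_zero_iff]
    exact fun l hl => sub_ne_zero.mpr (hne l (Finset.mem_range.mp hl)).symm
  set c := (f t - N.eval t) / (blockNodal x r i).eval t with hc
  have hder : ∀ e, derivative^[e] (N + C c * blockNodal x r i) =
      derivative^[e] N + C c * derivative^[e] (blockNodal x r i) := fun e => by
    rw [iterate_map_add, iterate_derivative_C_mul]
  obtain ⟨ξ, hξ, h0⟩ := exists_iterated_rolle (A := A) (B := B) (n := r)
    (G := fun e y => iteratedDerivWithin e f (Set.Icc a b) y -
      (derivative^[e] (N + C c * blockNodal x r i)).eval y)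
    (M := t ::ₘ blockKnots x r i) (by simp)
    (fun p hp => by
      rcases Multiset.mem_cons.mp hp with rfl | hp
      · exact ht
      · obtain ⟨l, hl, rfl⟩ := mem_blockKnots.mp hp; exact hmem l hl)
    (fun e he t ht => hasDerivWithinAt_sub_polynomial hab hf hsub _ he ht)
    (fun p e he => by
      rw [hder]
      by_cases hp : p = t
      · subst hp
        have h0 : (blockKnots x r i).count p = 0 := by
          rw [Multiset.count_eq_zero, mem_blockKnots]
          rintro ⟨l, hl, h⟩
          exact hne l hl h
        rw [Multiset.count_cons_self, h0] at he
        obtain rfl : e = 0 := by omega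
        simp only [iteratedDerivWithin_zero, Function.iterate_zero, id_eq, eval_add, eval_mul,
          eval_C]
        rw [hc, div_mul_cancel₀ _ hw]
        ring
      · rw [Multiset.count_cons_of_ne hp] at he
        rw [eval_add, eval_C_mul, iterate_derivative_blockNodal_eval he,
          iterate_derivative_newtonPoly_eval hx hi he]
        ring)
  refine ⟨ξ, hξ, ?_⟩
  rw [hder, iterate_derivative_eq_zero_of_degree_lt degree_newtonPoly_lt, zero_add,
    iterate_derivative_blockNodal_eq_C, ← C_mul, eval_C] at h0
  rw [sub_eq_zero.mp h0, hc]
  field_simp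

/-- The error of Hermite interpolation at `r + 1` knots near `t`, in terms of the oscillation of
the `r`-th derivative. The `r` knots whose distances to `t` enter the bound are obtained by
removing the first or the last of the `r + 1` knots. -/
theorem abs_sub_newtonPoly_le (hab : a < b) (hf : ContDiffOn ℝ r f (Set.Icc a b))
    (hx : MonotoneOn x (Set.Iio m)) {j : ℕ} (hij : j = i ∨ j = i + 1) (hi : i + r < m)
    (hmem : ∀ l < r + 1, x (i + l) ∈ Set.Icc a b) (ht : t ∈ Set.Icc a b)
    (hne : ∀ l < r + 1, x (i + l) ≠ t) {δ W : ℝ} (hδ : ∀ l < r + 1, |t - x (i + l)| ≤ δ)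
    (hW : ∀ ξ ∈ Set.Icc a b, ∀ η ∈ Set.Icc a b, |ξ - η| ≤ 2 * δ →
      |iteratedDerivWithin r f (Set.Icc a b) ξ - iteratedDerivWithin r f (Set.Icc a b) η| ≤ W) :
    |f t - (newtonPoly f (Set.Icc a b) x (r + 1) i).eval t| ≤
      (∏ l ∈ Finset.range r, |t - x (j + l)|) * W := by
  have hδ0 : 0 ≤ δ := (abs_nonneg _).trans (hδ 0 (by omega))
  have hsub : Set.Icc (max a (t - δ)) (min b (t + δ)) ⊆ Set.Icc a b :=
    Set.Icc_subset_Icc (le_max_left _ _) (min_le_left _ _)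
  have hmem' : ∀ l < r + 1, x (i + l) ∈ Set.Icc (max a (t - δ)) (min b (t + δ)) := fun l hl => by
    have := abs_le.mp (hδ l hl)
    exact ⟨max_le (hmem l hl).1 (by linarith), le_min (hmem l hl).2 (by linarith)⟩
  have ht' : t ∈ Set.Icc (max a (t - δ)) (min b (t + δ)) :=
    ⟨max_le ht.1 (by linarith), le_min ht.2 (by linarith)⟩
  have hshift : ∀ l < r, ∃ l' < r + 1, j + l = i + l' := fun l hl => by
    rcases hij with rfl | rfl
    · exact ⟨l, by omega, rfl⟩
    · exact ⟨l + 1, by omega, by ring⟩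
  obtain ⟨η, hη, hη'⟩ := exists_divDiff_eq hab hf hx hi hsub hmem'
  obtain ⟨ξ, hξ, hξ'⟩ := exists_newtonPoly_error_eq (i := j) hab hf hx
    (by rcases hij with rfl | rfl <;> omega) hsub
    (fun l hl => by obtain ⟨l', hl', h⟩ := hshift l hl; rw [h]; exact hmem' l' hl') ht'
    (fun l hl => by obtain ⟨l', hl', h⟩ := hshift l hl; rw [h]; exact hne l' hl')
  have hsplit : newtonPoly f (Set.Icc a b) x (r + 1) i = newtonPoly f (Set.Icc a b) x r j +
      C (divDiff f (Set.Icc a b) x r i) * blockNodal x r j := by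
    rcases hij with rfl | rfl
    · exact newtonPoly_succ
    · exact newtonPoly_succ' hx hi
  have hfac : (1 : ℝ) ≤ r.factorial := by exact_mod_cast r.factorial_pos
  have key : (r.factorial : ℝ) * (f t - (newtonPoly f (Set.Icc a b) x (r + 1) i).eval t) =
      (blockNodal x r j).eval t * (iteratedDerivWithin r f (Set.Icc a b) ξ -
        iteratedDerivWithin r f (Set.Icc a b) η) := by
    rw [hsplit, eval_add, eval_C_mul, mul_sub (eval t (blockNodal x r j)), ← hξ', ← hη']
    ring
  have hdist : |ξ - η| ≤ 2 * δ := by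
    rw [abs_le]
    have h1 := (le_max_right _ _).trans hξ.1
    have h2 := hξ.2.trans (min_le_right _ _)
    have h3 := (le_max_right _ _).trans hη.1
    have h4 := hη.2.trans (min_le_right _ _)
    constructor <;> linarith
  calc |f t - (newtonPoly f (Set.Icc a b) x (r + 1) i).eval t|
      ≤ (r.factorial : ℝ) * |f t - (newtonPoly f (Set.Icc a b) x (r + 1) i).eval t| :=
        le_mul_of_one_le_left (abs_nonneg _) hfac
    _ = |(blockNodal x r j).eval t| * |iteratedDerivWithin r f (Set.Icc a b) ξ -
        iteratedDerivWithin r f (Set.Icc a b) η| := by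
        rw [← abs_mul, ← key, abs_mul, Nat.abs_cast]
    _ ≤ _ := by
        rw [abs_eval_blockNodal]
        exact mul_le_mul_of_nonneg_left (hW ξ (hsub hξ) η (hsub hη) hdist)
          (Finset.prod_nonneg fun _ _ => abs_nonneg _)

/-- A knot next to a block lies no farther from `t` than any knot beyond it or the block. -/
theorem abs_sub_le_of_between {y z w t d : ℝ} (h1 : y ≤ z) (h2 : z ≤ w) (hy : |t - y| ≤ d)
    (hw : |t - w| ≤ d) : |t - z| ≤ d := by
  rw [abs_le] at *
  constructor <;> linarith

/-- For each `q` some `q + 1` consecutive knots are at least as close to `t` as the first `q + 1`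
knots in the order of distance, and so are `q` consecutive ones among them. -/
theorem exists_near_block (hx : MonotoneOn x (Set.Iio m)) {σ : ℕ → ℕ}
    (hσ : IsDistanceOrder σ x m t) {q : ℕ} (hq : q < m) :
    ∃ i j, (j = i ∨ j = i + 1) ∧ i + q < m ∧
      (∏ l ∈ Finset.range q, |t - x (j + l)|) ≤ ∏ ν ∈ Finset.range q, |t - x (σ ν)| ∧
      (∏ l ∈ Finset.range (q + 1), |t - x (i + l)|) ≤
        ∏ ν ∈ Finset.range (q + 1), |t - x (σ ν)| ∧
      ∀ l < q + 1, |t - x (i + l)| ≤ |t - x (σ q)| := by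
  induction q with
  | zero =>
    have h0 : σ 0 < m := hσ.1.mapsTo (Set.mem_Iio.mpr hq)
    refine ⟨σ 0, σ 0, Or.inl rfl, h0, by simp, by simp, fun l hl => ?_⟩
    obtain rfl : l = 0 := by omega
    simp
  | succ q ih =>
    obtain ⟨i, -, -, hi, -, hprod, hdist⟩ := ih (by omega)
    have hstep : |t - x (σ q)| ≤ |t - x (σ (q + 1))| := hσ.2 q hq
    have hmono : ∀ ν ≤ q + 1, |t - x (σ ν)| ≤ |t - x (σ (q + 1))| := by
      have : ∀ d ν, ν + d = q + 1 → |t - x (σ ν)| ≤ |t - x (σ (q + 1))| := by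
        intro d
        induction d with
        | zero => rintro ν rfl; exact le_rfl
        | succ d ihd =>
          intro ν hν
          exact (hσ.2 ν (by omega)).trans (ihd (ν + 1) (by omega))
      exact fun ν hν => this (q + 1 - ν) ν (by omega)
    obtain ⟨ν, hν, hνi⟩ : ∃ ν ∈ Finset.range (q + 2), σ ν ∉ Finset.Ico i (i + (q + 1)) := by
      by_contra! hcon
      have hinj : Set.InjOn σ (Finset.range (q + 2)) := hσ.1.injOn.mono fun ν hν => by
        simp only [Finset.coe_range, Set.mem_Iio] at hν ⊢
        omega
      have := Finset.card_le_card_of_injOn σ hcon hinj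
      simp at this
    rw [Finset.mem_range] at hν
    rw [Finset.mem_Ico, not_and_or, not_le, not_lt] at hνi
    have hσν : σ ν < m := hσ.1.mapsTo (Set.mem_Iio.mpr (by omega))
    have hdν := hmono ν (by omega)
    rcases hνi with hlt | hge
    · obtain ⟨i', rfl⟩ : ∃ i', i = i' + 1 := ⟨i - 1, by omega⟩
      have hnew : |t - x i'| ≤ |t - x (σ (q + 1))| :=
        abs_sub_le_of_between (hx (by simpa using hσν) (by simp; omega) (by omega))
          (hx (by simp; omega) (by simp; omega) (by omega)) hdν
          ((hdist 0 (by omega)).trans hstep)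
      refine ⟨i', i' + 1, Or.inr rfl, by omega, hprod, ?_, ?_⟩
      · rw [Finset.prod_range_succ', Finset.prod_range_succ _ (q + 1)]
        refine mul_le_mul ?_ (by simpa using hnew) (abs_nonneg _)
          (Finset.prod_nonneg fun _ _ => abs_nonneg _)
        simpa only [add_assoc, add_comm 1] using hprod
      · intro l hl
        rcases l with _ | l
        · simpa using hnew
        · have := hdist l (by omega)
          rw [add_right_comm, add_assoc] at this
          exact this.trans hstep
    · have hnew : |t - x (i + (q + 1))| ≤ |t - x (σ (q + 1))| :=
        abs_sub_le_of_between (hx (by simp; omega) (by simp; omega) (by omega))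
          (hx (by simp; omega) (by simpa using hσν) (by omega))
          ((hdist q (by omega)).trans hstep) hdν
      refine ⟨i, i, Or.inl rfl, by omega, hprod, ?_, ?_⟩
      · rw [Finset.prod_range_succ, Finset.prod_range_succ _ (q + 1)]
        exact mul_le_mul hprod hnew (abs_nonneg _)
          (Finset.prod_nonneg fun _ _ => abs_nonneg _)
      · intro l hl
        rcases Nat.lt_succ_iff_lt_or_eq.mp hl with h | rfl
        · exact (hdist l h).trans hstep
        · exact hnew

variable {lam K : ℝ}

/-- Divided differences of order at least `r` for knots of which no `r + 2` are close. -/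
theorem abs_divDiff_le (hab : a < b) (hf : ContDiffOn ℝ r f (Set.Icc a b))
    (hx : MonotoneOn x (Set.Iio m)) (hmem : ∀ l < m, x l ∈ Set.Icc a b) (hlam : 0 < lam)
    (hsep : ∀ j, j + r + 1 < m → lam * (b - a) ≤ x (j + r + 1) - x j)
    (hK : ∀ y ∈ Set.Icc a b, |iteratedDerivWithin r f (Set.Icc a b) y| ≤ K) (q : ℕ) :
    ∀ i, i + (r + q) < m →
      |divDiff f (Set.Icc a b) x (r + q) i| ≤ (2 / (lam * (b - a))) ^ q * K := by
  have hh : 0 < lam * (b - a) := mul_pos hlam (sub_pos.mpr hab)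
  induction q with
  | zero =>
    intro i hi
    obtain ⟨η, hη, h⟩ := exists_divDiff_eq hab hf hx hi le_rfl fun l hl => hmem _ (by omega)
    have hfac : (1 : ℝ) ≤ r.factorial := by exact_mod_cast r.factorial_pos
    calc |divDiff f (Set.Icc a b) x (r + 0) i|
        ≤ r.factorial * |divDiff f (Set.Icc a b) x r i| :=
          le_mul_of_one_le_left (abs_nonneg _) hfac
      _ = |iteratedDerivWithin r f (Set.Icc a b) η| := by rw [← h, abs_mul, Nat.abs_cast]
      _ ≤ _ := by simpa using hK η hη
  | succ q ih =>
    intro i hi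
    have hgap : lam * (b - a) ≤ x (i + (r + q + 1)) - x i := by
      have h1 := hsep i (by omega)
      have h2 : x (i + r + 1) ≤ x (i + (r + q + 1)) :=
        hx (by simp; omega) (by simp; omega) (by omega)
      linarith
    have hpos := hh.trans_le hgap
    rw [← add_assoc, divDiff_of_ne (sub_ne_zero.mp hpos.ne'), abs_div, abs_of_pos hpos,
      div_le_iff₀ hpos]
    have hK0 : 0 ≤ (2 / (lam * (b - a))) ^ (q + 1) * K :=
      mul_nonneg (by positivity) ((abs_nonneg _).trans (hK a ⟨le_rfl, hab.le⟩))
    calc |divDiff f (Set.Icc a b) x (r + q) (i + 1) - divDiff f (Set.Icc a b) x (r + q) i|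
        ≤ (2 / (lam * (b - a))) ^ q * K + (2 / (lam * (b - a))) ^ q * K :=
          (abs_sub _ _).trans (add_le_add (ih _ (by omega)) (ih _ (by omega)))
      _ = (2 / (lam * (b - a))) ^ (q + 1) * K * (lam * (b - a)) := by
          rw [pow_succ, mul_right_comm _ _ K, mul_assoc _ _ (lam * (b - a)),
            div_mul_cancel₀ _ hh.ne']
          ring
      _ ≤ _ := mul_le_mul_of_nonneg_left hgap hK0

/-- Extending a block of `r + 1` knots to larger blocks changes the interpolant by a controlled
amount. -/
theorem abs_newtonPoly_sub_le (hab : a < b) (hf : ContDiffOn ℝ r f (Set.Icc a b))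
    (hx : MonotoneOn x (Set.Iio m)) (hmem : ∀ l < m, x l ∈ Set.Icc a b) (hlam : 0 < lam)
    (hlam1 : lam ≤ 1)
    (hsep : ∀ j, j + r + 1 < m → lam * (b - a) ≤ x (j + r + 1) - x j)
    (hK : ∀ y ∈ Set.Icc a b, |iteratedDerivWithin r f (Set.Icc a b) y| ≤ K)
    (ht : t ∈ Set.Icc a b) {i₀ : ℕ} (q : ℕ) :
    ∀ i, i ≤ i₀ → i₀ ≤ i + q → i + (r + 1 + q) ≤ m →
      |(newtonPoly f (Set.Icc a b) x (r + 1 + q) i).eval t -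
          (newtonPoly f (Set.Icc a b) x (r + 1) i₀).eval t| ≤
        q * ((∏ l ∈ Finset.range (r + 1), |t - x (i₀ + l)|) * ((2 / lam) ^ m * (K / (b - a)))) ∧
      ∏ l ∈ Finset.range (r + 1 + q), |t - x (i + l)| ≤
        (∏ l ∈ Finset.range (r + 1), |t - x (i₀ + l)|) * (b - a) ^ q := by
  have hh : 0 < b - a := sub_pos.mpr hab
  have hd : ∀ l < m, |t - x l| ≤ b - a := fun l hl => by
    have := hmem l hl
    rw [abs_le]
    constructor <;> linarith [this.1, this.2, ht.1, ht.2]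
  have hK0 : 0 ≤ K := (abs_nonneg _).trans (hK a ⟨le_rfl, hab.le⟩)
  set D := ∏ l ∈ Finset.range (r + 1), |t - x (i₀ + l)| with hD
  have hD0 : 0 ≤ D := Finset.prod_nonneg fun _ _ => abs_nonneg _
  induction q with
  | zero =>
    intro i h1 h2 _
    obtain rfl : i = i₀ := by omega
    simp [hD]
  | succ q ih =>
    intro i h1 h2 h3
    have hstep : ∀ j, i + (r + 1 + q) < m →
        ∏ l ∈ Finset.range (r + 1 + q), |t - x (j + l)| ≤ D * (b - a) ^ q →
        |divDiff f (Set.Icc a b) x (r + 1 + q) i * (blockNodal x (r + 1 + q) j).eval t| ≤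
          D * ((2 / lam) ^ m * (K / (b - a))) := by
      intro j hi hprod
      have hdd := abs_divDiff_le hab hf hx hmem hlam hsep hK (q + 1) i (by omega)
      rw [show r + (q + 1) = r + 1 + q by ring] at hdd
      rw [abs_mul, abs_eval_blockNodal]
      have hone : (1 : ℝ) ≤ 2 / lam := by rw [le_div_iff₀ hlam]; linarith
      calc |divDiff f (Set.Icc a b) x (r + 1 + q) i| *
            ∏ l ∈ Finset.range (r + 1 + q), |t - x (j + l)|
          ≤ ((2 / (lam * (b - a))) ^ (q + 1) * K) * (D * (b - a) ^ q) :=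
            mul_le_mul hdd hprod (Finset.prod_nonneg fun _ _ => abs_nonneg _)
              (mul_nonneg (by positivity) hK0)
        _ = D * ((2 / lam) ^ (q + 1) * (K / (b - a))) := by
            rw [← div_div, div_pow (2 / lam), pow_succ (b - a)]
            field_simp
        _ ≤ _ := by
            gcongr
            omega
    rcases h1.lt_or_eq with hlt | rfl
    · obtain ⟨ih1, ih2⟩ := ih (i + 1) hlt (by omega) (by omega)
      constructor
      · rw [← add_assoc (r + 1), newtonPoly_succ' hx (by omega), eval_add, eval_C_mul]
        have := hstep (i + 1) (by omega) ih2
        rw [abs_le] at *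
        push_cast
        constructor <;> linarith
      · rw [← add_assoc (r + 1), Finset.prod_range_succ', pow_succ, ← mul_assoc]
        refine mul_le_mul ?_ (by simpa using hd i (by omega)) (abs_nonneg _) (by positivity)
        simpa only [add_assoc, add_comm 1] using ih2
    · obtain ⟨ih1, ih2⟩ := ih i le_rfl (by omega) (by omega)
      constructor
      · rw [← add_assoc (r + 1), newtonPoly_succ, eval_add, eval_C_mul]
        have := hstep i (by omega) ih2
        rw [abs_le] at *
        push_cast
        constructor <;> linarith
      · rw [← add_assoc (r + 1), Finset.prod_range_succ, pow_succ, ← mul_assoc]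
        exact mul_le_mul ih2 (hd _ (by omega)) (abs_nonneg _) (by positivity)

/-- The interpolation error in terms of the oscillation and of the size of the `r`-th
derivative. -/
theorem abs_sub_hermitePoly_le (hab : a < b) (hf : ContDiffOn ℝ r f (Set.Icc a b))
    (hr : r < m) (hx : MonotoneOn x (Set.Iio m)) (hmem : ∀ l < m, x l ∈ Set.Icc a b)
    (hlam : 0 < lam) (hlam1 : lam ≤ 1)
    (hsep : ∀ j, j + r + 1 < m → lam * (b - a) ≤ x (j + r + 1) - x j)
    (hK : ∀ y ∈ Set.Icc a b, |iteratedDerivWithin r f (Set.Icc a b) y| ≤ K)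
    (ht : t ∈ Set.Icc a b) (hne : ∀ l < m, x l ≠ t) {σ : ℕ → ℕ} (hσ : IsDistanceOrder σ x m t)
    {W : ℝ}
    (hW : ∀ ξ ∈ Set.Icc a b, ∀ η ∈ Set.Icc a b, |ξ - η| ≤ 2 * |t - x (σ r)| →
      |iteratedDerivWithin r f (Set.Icc a b) ξ - iteratedDerivWithin r f (Set.Icc a b) η| ≤ W) :
    |f t - (hermitePoly f (Set.Icc a b) x m).eval t| ≤
      (∏ ν ∈ Finset.range r, |t - x (σ ν)|) * W +
        distProd σ x r t * (m * ((2 / lam) ^ m * (K / (b - a)))) := by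
  obtain ⟨i, j, hij, hi, hprod, hprod', hdist⟩ := exists_near_block hx hσ hr
  have hW0 : 0 ≤ W := (abs_nonneg _).trans (hW t ht t ht (by simp))
  have hK0 : 0 ≤ K := (abs_nonneg _).trans (hK a ⟨le_rfl, hab.le⟩)
  have hh : 0 < b - a := sub_pos.mpr hab
  have h1 := abs_sub_newtonPoly_le hab hf hx hij hi (fun l hl => hmem _ (by omega)) ht
    (fun l hl => hne _ (by omega)) hdist hW
  have h2 := (abs_newtonPoly_sub_le hab hf hx hmem hlam hlam1 hsep hK ht (i₀ := i) (m - (r + 1))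
    0 (by omega) (by omega) (by omega)).1
  rw [show r + 1 + (m - (r + 1)) = m by omega, ← hermitePoly_eq_newtonPoly] at h2
  have h3 : ((m - (r + 1) : ℕ) : ℝ) * ((∏ l ∈ Finset.range (r + 1), |t - x (i + l)|) *
      ((2 / lam) ^ m * (K / (b - a)))) ≤
      distProd σ x r t * (m * ((2 / lam) ^ m * (K / (b - a)))) := by
    have hcast : ((m - (r + 1) : ℕ) : ℝ) ≤ m := by exact_mod_cast Nat.sub_le _ _
    have hP : 0 ≤ (2 / lam) ^ m * (K / (b - a)) := by positivity
    calc _ ≤ (m : ℝ) * (distProd σ x r t * ((2 / lam) ^ m * (K / (b - a)))) :=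
          mul_le_mul hcast (mul_le_mul_of_nonneg_right hprod' hP)
            (mul_nonneg (Finset.prod_nonneg fun _ _ => abs_nonneg _) hP) (by positivity)
      _ = _ := by ring
  have h4 := h1.trans (mul_le_mul_of_nonneg_right hprod hW0)
  rw [abs_le] at *
  constructor <;> linarith

end

theorem fwdDiff_iter_comp_natCast (F : ℝ → ℝ) (k : ℕ) (x v : ℝ) (j : ℕ) :
    (fwdDiff 1)^[k] (fun j : ℕ => F (x + j * v)) j = (fwdDiff v)^[k] F (x + j * v) := by
  rw [fwdDiff_iter_eq_sum_shift, fwdDiff_iter_eq_sum_shift]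
  refine Finset.sum_congr rfl fun i _ => ?_
  congr 2
  simp only [nsmul_eq_mul]
  push_cast
  ring

theorem fwdDiff_iter_eval_eq_zero {P : ℝ[X]} {k : ℕ} (hP : P.natDegree < k) (x v : ℝ) :
    (fwdDiff v)^[k] (fun y => P.eval y) x = 0 := by
  have hQ : (P.comp (C v * X + C x)).natDegree < k := by
    refine lt_of_le_of_lt natDegree_comp_le (lt_of_le_of_lt ?_ hP)
    exact (Nat.mul_le_mul_left _ natDegree_linear_le).trans (mul_one _).le
  have h := congrFun (fwdDiff_iter_eq_zero_of_degree_lt hQ) 0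
  rw [fwdDiff_iter_eq_sum_shift] at h ⊢
  refine Eq.trans (Finset.sum_congr rfl fun i _ => ?_) h
  congr 1
  simp only [eval_comp, eval_add, eval_mul, eval_C, eval_X, nsmul_eq_mul]
  congr 1
  ring

theorem fwdDiff_iter_sub (F G : ℝ → ℝ) (k : ℕ) (x v : ℝ) :
    (fwdDiff v)^[k] (fun y => F y - G y) x =
      (fwdDiff v)^[k] F x - (fwdDiff v)^[k] G x := by
  simp only [fwdDiff_iter_eq_sum_shift, smul_sub, Finset.sum_sub_distrib]

/-- A sequence that vanishes at `0, …, k - 1` is controlled by its differences of order `k`. -/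
theorem abs_le_of_abs_fwdDiff_iter_le {k M : ℕ} (hk : 0 < k) {G : ℕ → ℝ} {ε : ℝ} (hε : 0 ≤ ε)
    (h0 : ∀ i < k, G i = 0) (hΔ : ∀ j, j + k ≤ M → |(fwdDiff 1)^[k] G j| ≤ ε) (j : ℕ)
    (hj : j ≤ M) : |G j| ≤ (2 ^ k + 1) ^ j * ε := by
  induction j using Nat.strong_induction_on with
  | _ j ih =>
    rcases lt_or_ge j k with hjk | hjk
    · rw [h0 j hjk, abs_zero]; positivity
    · obtain ⟨i, rfl⟩ : ∃ i, j = i + k := ⟨j - k, by omega⟩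
      have hd := hΔ i hj
      rw [fwdDiff_iter_eq_sum_shift, Finset.sum_range_succ] at hd
      simp only [Nat.sub_self, pow_zero, Nat.choose_self, nsmul_eq_mul, mul_one, Nat.cast_id,
        Nat.cast_one, one_zsmul] at hd
      have hsum : |∑ l ∈ Finset.range k, ((-1) ^ (k - l) * (k.choose l : ℤ)) • G (i + l)| ≤
          2 ^ k * ((2 ^ k + 1) ^ (i + k - 1) * ε) := by
        calc _ ≤ ∑ l ∈ Finset.range k, |((-1) ^ (k - l) * (k.choose l : ℤ)) • G (i + l)| :=
              Finset.abs_sum_le_sum_abs _ _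
          _ ≤ ∑ l ∈ Finset.range k, (k.choose l : ℝ) * ((2 ^ k + 1) ^ (i + k - 1) * ε) := by
              refine Finset.sum_le_sum fun l hl => ?_
              rw [Finset.mem_range] at hl
              rw [zsmul_eq_mul, abs_mul]
              push_cast
              rw [abs_mul, abs_pow, abs_neg, abs_one, one_pow, one_mul, Nat.abs_cast]
              refine mul_le_mul_of_nonneg_left ((ih (i + l) (by omega) (by omega)).trans ?_)
                (Nat.cast_nonneg _)
              refine mul_le_mul_of_nonneg_right (pow_le_pow_right₀ ?_ (by omega)) hε
              linarith [show (0 : ℝ) ≤ 2 ^ k by positivity]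
          _ = (∑ l ∈ Finset.range k, (k.choose l : ℝ)) * ((2 ^ k + 1) ^ (i + k - 1) * ε) := by
              rw [Finset.sum_mul]
          _ ≤ _ := by
              refine mul_le_mul_of_nonneg_right ?_ (by positivity)
              have h1 := Nat.sum_range_choose k
              rw [Finset.sum_range_succ] at h1
              exact_mod_cast (Nat.le_add_right _ _).trans h1.le
      have h1 : ε ≤ (2 ^ k + 1) ^ (i + k - 1) * ε :=
        le_mul_of_one_le_left hε (one_le_pow₀ (by linarith [show (0 : ℝ) ≤ 2 ^ k by positivity]))
      have h2 : ((2 : ℝ) ^ k + 1) ^ (i + k) * ε =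
          2 ^ k * ((2 ^ k + 1) ^ (i + k - 1) * ε) + (2 ^ k + 1) ^ (i + k - 1) * ε := by
        conv_lhs => rw [show i + k = i + k - 1 + 1 by omega, pow_succ]
        ring
      rw [h2]
      rw [abs_le] at *
      constructor <;> linarith

theorem exists_abs_eval_sub_le (P : ℝ[X]) :
    ∃ c : ℝ, 0 ≤ c ∧ ∀ s ∈ Set.Icc (0 : ℝ) 1, |P.eval s - P.eval 0| ≤ c * s := by
  obtain ⟨c, hc⟩ := (isCompact_Icc (a := (0 : ℝ)) (b := 1)).exists_bound_of_continuousOn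
    (f := fun s => P.divX.eval s) P.divX.continuous.continuousOn
  refine ⟨c, (norm_nonneg _).trans (hc 0 (by simp)), fun s hs => ?_⟩
  have h : P.eval s = P.divX.eval s * s + P.coeff 0 := by
    conv_lhs => rw [← P.divX_mul_X_add]
    simp
  rw [h, ← coeff_zero_eq_eval_zero, add_sub_cancel_right, abs_mul, abs_of_nonneg hs.1]
  exact mul_le_mul_of_nonneg_right (hc s hs) hs.1

/-- A polynomial of degree less than `k` is Lipschitz at `0`, with a constant determined by its
values at `k` given nodes. -/
theorem exists_abs_eval_sub_le_of_nodes (k : ℕ) {v : ℕ → ℝ} (hv : Function.Injective v) :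
    ∃ c : ℝ, 0 ≤ c ∧ ∀ (P : ℝ[X]) (ε : ℝ), P.degree < k → (∀ i < k, |P.eval (v i)| ≤ ε) →
      ∀ s ∈ Set.Icc (0 : ℝ) 1, |P.eval s - P.eval 0| ≤ c * ε * s := by
  choose c hc0 hc using fun i => exists_abs_eval_sub_le (Lagrange.basis (Finset.range k) v i)
  refine ⟨∑ i ∈ Finset.range k, c i, Finset.sum_nonneg fun i _ => hc0 i, fun P ε hP hε s hs => ?_⟩
  have hPe := Lagrange.eq_interpolate (s := Finset.range k) (f := P) hv.injOn (by simpa using hP)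
  rw [Lagrange.interpolate_apply] at hPe
  have hval : ∀ y, P.eval y = ∑ i ∈ Finset.range k,
      P.eval (v i) * (Lagrange.basis (Finset.range k) v i).eval y := fun y => by
    conv_lhs => rw [hPe]
    simp [eval_finsetSum]
  rw [hval s, hval 0, ← Finset.sum_sub_distrib, Finset.sum_mul, Finset.sum_mul]
  refine (Finset.abs_sum_le_sum_abs _ _).trans (Finset.sum_le_sum fun i hi => ?_)
  rw [← mul_sub, abs_mul]
  calc _ ≤ ε * (c i * s) := mul_le_mul (hε i (Finset.mem_range.mp hi)) (hc i s hs) (abs_nonneg _)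
        ((abs_nonneg _).trans (hε i (Finset.mem_range.mp hi)))
    _ = _ := by ring

/-- `Ω` bounds the differences of order `k` of `g` on `[a,b]`. -/
def DiffBound (k : ℕ) (Ω : ℝ → ℝ) (g : ℝ → ℝ) (a b : ℝ) : Prop :=
  ∀ x v : ℝ, x ∈ Set.Icc a b → x + k * v ∈ Set.Icc a b → |(fwdDiff v)^[k] g x| ≤ Ω |v|

theorem DiffBound.sub_polynomial {k : ℕ} {Ω g : ℝ → ℝ} {a b : ℝ} (h : DiffBound k Ω g a b)
    {P : ℝ[X]} (hP : P.natDegree < k) : DiffBound k Ω (fun y => g y - P.eval y) a b := by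
  intro x v hx hv
  rw [fwdDiff_iter_sub, fwdDiff_iter_eval_eq_zero hP, sub_zero]
  exact h x v hx hv

theorem add_mul_mem_Icc {a b x v c d : ℝ} (hx : x ∈ Set.Icc a b) (hd : x + d * v ∈ Set.Icc a b)
    (hc : 0 ≤ c) (hcd : c ≤ d) : x + c * v ∈ Set.Icc a b := by
  rcases le_total 0 v with hv | hv
  · exact ⟨by nlinarith [hx.1, mul_nonneg hc hv],
      by nlinarith [hd.2, mul_le_mul_of_nonneg_right hcd hv]⟩
  · exact ⟨by nlinarith [hd.1, mul_le_mul_of_nonpos_right hcd hv],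
      by nlinarith [hx.2, mul_nonneg_of_nonpos_of_nonpos (neg_nonpos.mpr hc) hv]⟩

/-- The polynomial `q` of degree less than `k` with `q(i) = g(x + i v)` for `i < k`. -/
noncomputable def gridInterp (k : ℕ) (g : ℝ → ℝ) (x v : ℝ) : ℝ[X] :=
  Lagrange.interpolate (Finset.range k) (fun i : ℕ => (i : ℝ)) fun i => g (x + i * v)

section Grid

variable {k : ℕ} {g Ω : ℝ → ℝ} {a b x v : ℝ}

theorem eval_gridInterp {i : ℕ} (hi : i < k) : (gridInterp k g x v).eval (i : ℝ) = g (x + i * v) :=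
  Lagrange.eval_interpolate_at_node (v := fun i : ℕ => (i : ℝ)) (fun i : ℕ => g (x + i * v))
    Nat.cast_injective.injOn (Finset.mem_range.mpr hi)

theorem degree_gridInterp_lt : (gridInterp k g x v).degree < k := by
  refine (Lagrange.degree_interpolate_lt (fun i : ℕ => g (x + i * v))
    (Nat.cast_injective (R := ℝ)).injOn).trans_eq ?_
  rw [Finset.card_range]

theorem natDegree_lt_of_degree_lt' {P : ℝ[X]} (hk : 0 < k) (hP : P.degree < k) :
    P.natDegree < k := by
  rcases eq_or_ne P 0 with rfl | h
  · simpa using hk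
  · exact (natDegree_lt_iff_degree_lt h).mpr hP

/-- On a grid `x, x + v, …, x + M v` in `[a,b]` the function is close to its interpolant at the
first `k` points. -/
theorem DiffBound.abs_sub_gridInterp_le (h : DiffBound k Ω g a b) (hΩ : ∀ t, 0 ≤ Ω t) (hk : 0 < k)
    (hx : x ∈ Set.Icc a b) {M j : ℕ} (hM : x + M * v ∈ Set.Icc a b) (hj : j ≤ M) :
    |g (x + j * v) - (gridInterp k g x v).eval (j : ℝ)| ≤ (2 ^ k + 1) ^ j * Ω |v| := by
  refine abs_le_of_abs_fwdDiff_iter_le (M := M) hk (hΩ _)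
    (G := fun j : ℕ => g (x + j * v) - (gridInterp k g x v).eval (j : ℝ))
    (fun i hi => by simp [eval_gridInterp hi]) (fun i hi => ?_) j hj
  have h1 := fwdDiff_iter_comp_natCast g k x v i
  have h2 := fwdDiff_iter_comp_natCast (fun y => (gridInterp k g x v).eval y) k 0 1 i
  rw [fwdDiff_iter_eval_eq_zero (natDegree_lt_of_degree_lt' hk degree_gridInterp_lt)] at h2
  have h3 : (fwdDiff 1)^[k]
      (fun j : ℕ => g (x + j * v) - (gridInterp k g x v).eval (j : ℝ)) i =
      (fwdDiff v)^[k] g (x + i * v) := by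
    rw [← h1, ← sub_zero ((fwdDiff 1)^[k] (fun j : ℕ => g (x + j * v)) i), ← h2]
    simp only [fwdDiff_iter_eq_sum_shift, smul_sub, Finset.sum_sub_distrib, zero_add, mul_one]
  rw [h3]
  have hiM : (i : ℝ) + k ≤ M := by exact_mod_cast hi
  refine h _ _ (add_mul_mem_Icc hx hM (Nat.cast_nonneg _)
    (by linarith [(Nat.cast_nonneg k : (0 : ℝ) ≤ k)])) ?_
  rw [add_assoc, ← add_mul]
  exact add_mul_mem_Icc hx hM (by positivity) hiM

end Grid

/-- Doubling the step of the grid changes the increments of the interpolant by little. -/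
theorem exists_gridInterp_step (k : ℕ) (hk : 0 < k) :
    ∃ c : ℝ, 0 ≤ c ∧ ∀ (g Ω : ℝ → ℝ) (a b : ℝ), DiffBound k Ω g a b → (∀ t, 0 ≤ Ω t) →
      ∀ x v : ℝ, x ∈ Set.Icc a b → x + (2 * (k - 1 : ℝ)) * v ∈ Set.Icc a b →
      ∀ s ∈ Set.Icc (0 : ℝ) 1,
        |((gridInterp k g x v).eval s - (gridInterp k g x v).eval 0) -
          ((gridInterp k g x (2 * v)).eval (s / 2) - (gridInterp k g x (2 * v)).eval 0)| ≤
          c * Ω |v| * s := by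
  obtain ⟨c, hc0, hc⟩ := exists_abs_eval_sub_le_of_nodes k (v := fun i : ℕ => 2 * (i : ℝ))
    (fun i j hij => by simpa using hij)
  refine ⟨c * (2 ^ k + 1) ^ (2 * (k - 1)), by positivity, ?_⟩
  intro g Ω a b h hΩ x v hx hv s hs
  set d := gridInterp k g x v - (gridInterp k g x (2 * v)).comp (C (1 / 2) * X) with hd
  have hdeval : ∀ y, d.eval y =
      (gridInterp k g x v).eval y - (gridInterp k g x (2 * v)).eval (y / 2) := fun y => by
    rw [hd, eval_sub, eval_comp, eval_mul, eval_C, eval_X]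
    congr 2
    ring
  have hdeg : d.degree < k := by
    refine lt_of_le_of_lt (degree_sub_le _ _) (max_lt degree_gridInterp_lt ?_)
    have h1 : ((gridInterp k g x (2 * v)).comp (C (1 / 2) * X)).natDegree < k := by
      refine lt_of_le_of_lt natDegree_comp_le (lt_of_le_of_lt ?_
        (natDegree_lt_of_degree_lt' hk (degree_gridInterp_lt (g := g) (x := x) (v := 2 * v))))
      exact (Nat.mul_le_mul_left _ ((natDegree_C_mul_le _ _).trans natDegree_X_le)).trans (mul_one _).le
    exact lt_of_le_of_lt degree_le_natDegree (by exact_mod_cast h1)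
  have hcast : ((2 * (k - 1) : ℕ) : ℝ) = 2 * (k - 1 : ℝ) := by
    rw [Nat.cast_mul, Nat.cast_sub (by omega)]; simp
  have hnodes : ∀ i < k, |d.eval (2 * (i : ℝ))| ≤ (2 ^ k + 1) ^ (2 * (k - 1)) * Ω |v| := by
    intro i hi
    have h1 := h.abs_sub_gridInterp_le hΩ hk hx (M := 2 * (k - 1)) (j := 2 * i)
      (by rw [hcast]; exact hv) (by omega)
    push_cast at h1
    have h2 : (gridInterp k g x (2 * v)).eval (2 * (i : ℝ) / 2) = g (x + 2 * i * v) := by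
      rw [mul_div_cancel_left₀ _ two_ne_zero, eval_gridInterp hi]
      congr 1
      ring
    rw [hdeval, h2, abs_sub_comm]
    refine h1.trans (mul_le_mul_of_nonneg_right (pow_le_pow_right₀ ?_ (by omega)) (hΩ _))
    linarith [show (0 : ℝ) ≤ 2 ^ k by positivity]
  have := hc d _ hdeg hnodes s hs
  rw [hdeval, hdeval, zero_div] at this
  calc _ = _ := by congr 1; ring
    _ ≤ _ := this
    _ = _ := by ring

/-- Marchaud's inequality along a ray from `x`. -/
theorem exists_marchaud_ray (k : ℕ) (hk : 2 ≤ k) :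
    ∃ c : ℝ, 0 ≤ c ∧ ∀ (g Ω : ℝ → ℝ) (a b B : ℝ), DiffBound k Ω g a b → (∀ t, 0 ≤ Ω t) →
      (∀ y ∈ Set.Icc a b, |g y| ≤ B) →
      ∀ (N : ℕ) (x v : ℝ), x ∈ Set.Icc a b → x + ((k - 1 : ℝ) * 2 ^ N) * v ∈ Set.Icc a b →
        |g (x + v) - g x| ≤
          c * (∑ n ∈ Finset.range N, Ω (2 ^ n * |v|) / 2 ^ n + B / 2 ^ N) := by
  obtain ⟨c₁, hc₁0, hc₁⟩ := exists_gridInterp_step k (by omega)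
  obtain ⟨c₂, hc₂0, hc₂⟩ := exists_abs_eval_sub_le_of_nodes k (v := fun i : ℕ => (i : ℝ))
    Nat.cast_injective
  refine ⟨max c₁ c₂, hc₁0.trans (le_max_left _ _), ?_⟩
  intro g Ω a b B h hΩ hB N x v hx hv
  have hB0 : 0 ≤ B := (abs_nonneg _).trans (hB x hx)
  have hk1 : (1 : ℝ) ≤ k - 1 := by
    have : (2 : ℝ) ≤ k := by exact_mod_cast hk
    linarith
  have main : ∀ (N : ℕ) (v : ℝ), x + ((k - 1 : ℝ) * 2 ^ N) * v ∈ Set.Icc a b →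
      ∀ s ∈ Set.Icc (0 : ℝ) 1,
        |(gridInterp k g x v).eval s - (gridInterp k g x v).eval 0| ≤
          max c₁ c₂ * s * (∑ n ∈ Finset.range N, Ω (2 ^ n * |v|) / 2 ^ n + B / 2 ^ N) := by
    intro N
    induction N with
    | zero =>
      intro v hv s hs
      refine (hc₂ _ B degree_gridInterp_lt (fun i hi => ?_) s hs).trans ?_
      · rw [eval_gridInterp hi]
        refine hB _ (add_mul_mem_Icc hx hv (Nat.cast_nonneg _) ?_)
        rw [pow_zero, mul_one, le_sub_iff_add_le]
        exact_mod_cast hi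
      · have : c₂ * B * s ≤ max c₁ c₂ * B * s := by
          have := hs.1
          gcongr
          exact le_max_right _ _
        simpa [mul_right_comm] using this
    | succ N ih =>
      intro v hv s hs
      have h1 := hc₁ g Ω a b h hΩ x v hx (add_mul_mem_Icc hx hv (by linarith) (by
        rw [pow_succ, mul_comm 2]
        have : (1 : ℝ) ≤ 2 ^ N := one_le_pow₀ (by norm_num)
        nlinarith)) s hs
      have h2 := ih (2 * v) (by
        convert hv using 2
        ring) (s / 2) ⟨by linarith [hs.1], by linarith [hs.2]⟩
      have h3 : c₁ * Ω |v| * s ≤ max c₁ c₂ * Ω |v| * s := by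
        have := hs.1
        have := hΩ |v|
        gcongr
        exact le_max_left _ _
      have h4 : max c₁ c₂ * (s / 2) *
          (∑ n ∈ Finset.range N, Ω (2 ^ n * |2 * v|) / 2 ^ n + B / 2 ^ N) =
          max c₁ c₂ * s *
          (∑ n ∈ Finset.range N, Ω (2 ^ (n + 1) * |v|) / 2 ^ (n + 1) + B / 2 ^ (N + 1)) := by
        have : ∑ n ∈ Finset.range N, Ω (2 ^ (n + 1) * |v|) / 2 ^ (n + 1) =
            (∑ n ∈ Finset.range N, Ω (2 ^ n * |2 * v|) / 2 ^ n) / 2 := by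
          rw [Finset.sum_div]
          refine Finset.sum_congr rfl fun n _ => ?_
          rw [abs_mul, abs_two, ← mul_assoc, ← pow_succ, pow_succ, div_div]
        rw [this, pow_succ]
        ring
      rw [h4] at h2
      rw [Finset.sum_range_succ', pow_zero, one_mul, div_one]
      rw [abs_le] at *
      constructor <;> linarith
  have := main N v hv 1 (by simp)
  have e1 : (gridInterp k g x v).eval 1 = g (x + v) := by
    simpa using eval_gridInterp (g := g) (x := x) (v := v) (show 1 < k by omega)
  have e0 : (gridInterp k g x v).eval 0 = g x := by
    simpa using eval_gridInterp (g := g) (x := x) (v := v) (show 0 < k by omega)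
  rwa [e1, e0, mul_one] at this

/-- Marchaud's inequality on an interval, in discrete form. -/
theorem exists_marchaud (k : ℕ) (hk : 2 ≤ k) :
    ∃ c : ℝ, 0 ≤ c ∧ ∀ (g Ω : ℝ → ℝ) (a b B : ℝ), DiffBound k Ω g a b → (∀ t, 0 ≤ Ω t) →
      Monotone Ω → (∀ y ∈ Set.Icc a b, |g y| ≤ B) →
      ∀ (N : ℕ) (τ : ℝ), (k - 1 : ℝ) * 2 ^ N * τ ≤ (b - a) / 2 →
      ∀ ξ ∈ Set.Icc a b, ∀ η ∈ Set.Icc a b, |ξ - η| ≤ τ →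
        |g ξ - g η| ≤ c * (∑ n ∈ Finset.range N, Ω (2 ^ n * τ) / 2 ^ n + B / 2 ^ N) := by
  obtain ⟨c, hc0, hc⟩ := exists_marchaud_ray k hk
  refine ⟨c, hc0, ?_⟩
  intro g Ω a b B h hΩ hmono hB N τ hτ ξ hξ η hη hd
  wlog hle : ξ ≤ η generalizing ξ η
  · rw [abs_sub_comm]
    exact this η hη ξ hξ (by rwa [abs_sub_comm]) (le_of_not_ge hle)
  have hk1 : (1 : ℝ) ≤ k - 1 := by
    have : (2 : ℝ) ≤ k := by exact_mod_cast hk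
    linarith
  have hd' : η - ξ ≤ τ := by rwa [abs_sub_comm, abs_of_nonneg (sub_nonneg.mpr hle)] at hd
  have hq : (k - 1 : ℝ) * 2 ^ N * (η - ξ) ≤ (b - a) / 2 :=
    (mul_le_mul_of_nonneg_left hd' (by positivity)).trans hτ
  have hq0 : 0 ≤ (k - 1 : ℝ) * 2 ^ N * (η - ξ) :=
    mul_nonneg (by positivity) (sub_nonneg.mpr hle)
  have hfin : ∀ v : ℝ, |v| ≤ τ →
      c * (∑ n ∈ Finset.range N, Ω (2 ^ n * |v|) / 2 ^ n + B / 2 ^ N) ≤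
        c * (∑ n ∈ Finset.range N, Ω (2 ^ n * τ) / 2 ^ n + B / 2 ^ N) := fun v hv => by
    gcongr
    exact hmono (by gcongr)
  rcases le_total ξ ((a + b) / 2) with hmid | hmid
  · have := hc g Ω a b B h hΩ hB N ξ (η - ξ) hξ
      ⟨by linarith [hξ.1], by linarith⟩
    rw [add_sub_cancel, abs_sub_comm] at this
    exact this.trans (hfin _ (by rwa [abs_sub_comm]))
  · have := hc g Ω a b B h hΩ hB N η (ξ - η) hη
      ⟨by nlinarith [hη.1], by nlinarith [hη.2]⟩
    rw [add_sub_cancel] at this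
    exact this.trans (hfin _ hd)

/-- Whitney's inequality: a continuous function is approximated by polynomials of degree less than
`k` with an error controlled by its differences of order `k`. -/
theorem exists_whitney (k : ℕ) (hk : 2 ≤ k) :
    ∃ c : ℝ, 0 ≤ c ∧ ∀ (g Ω : ℝ → ℝ) (a b : ℝ), a < b → ContinuousOn g (Set.Icc a b) →
      DiffBound k Ω g a b → (∀ t, 0 ≤ Ω t) → Monotone Ω →
      ∃ P : ℝ[X], P.degree < k ∧ ∀ y ∈ Set.Icc a b, |g y - P.eval y| ≤ c * Ω (b - a) := by
  obtain ⟨c, hc0, hc⟩ := exists_marchaud k hk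
  obtain ⟨N, hN⟩ : ∃ N : ℕ, 2 * c ≤ 2 ^ N :=
    (pow_unbounded_of_one_lt (2 * c) one_lt_two).imp fun _ h => h.le
  set M : ℕ := 2 * (k - 1) * 2 ^ N with hMdef
  have hcast : (M : ℝ) = 2 * (k - 1 : ℝ) * 2 ^ N := by
    rw [hMdef]; push_cast [Nat.cast_sub (show 1 ≤ k by omega)]; ring
  have hk1 : (1 : ℝ) ≤ k - 1 := by
    have : (2 : ℝ) ≤ k := by exact_mod_cast hk
    linarith
  have h2N : (0 : ℝ) < 2 ^ N := by positivity
  have hM2 : (2 : ℝ) ^ N ≤ M := by rw [hcast]; nlinarith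
  have hM0 : (0 : ℝ) < M := h2N.trans_le hM2
  refine ⟨2 * ((2 ^ k + 1) ^ M + c * N), by positivity, ?_⟩
  intro g Ω a b hab hg h hΩ hmono
  have hh : 0 < b - a := sub_pos.mpr hab
  set τ := (b - a) / M with hτ
  have hτ0 : 0 < τ := by positivity
  have hMτ : M * τ = b - a := by rw [hτ]; field_simp
  have hτne := hτ0.ne'
  set P := (gridInterp k g a τ).comp (C τ⁻¹ * X + C (-(a * τ⁻¹))) with hP
  have hPdeg : P.natDegree < k := by
    refine lt_of_le_of_lt natDegree_comp_le (lt_of_le_of_lt ?_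
      (natDegree_lt_of_degree_lt' (k := k) (by omega)
        (degree_gridInterp_lt (g := g) (x := a) (v := τ))))
    exact (Nat.mul_le_mul_left _ natDegree_linear_le).trans (mul_one _).le
  have hPeval : ∀ j : ℕ, P.eval (a + j * τ) = (gridInterp k g a τ).eval (j : ℝ) := fun j => by
    rw [hP, eval_comp]
    congr 1
    simp only [eval_add, eval_mul, eval_C, eval_X]
    field_simp
    ring
  refine ⟨P, lt_of_le_of_lt degree_le_natDegree (by exact_mod_cast hPdeg), ?_⟩
  obtain ⟨y₀, hy₀, hmax⟩ := (isCompact_Icc (a := a) (b := b)).exists_isMaxOn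
    (Set.nonempty_Icc.mpr hab.le) (hg.sub P.continuous.continuousOn).abs
  set B := |g y₀ - P.eval y₀| with hBdef
  have hB : ∀ y ∈ Set.Icc a b, |g y - P.eval y| ≤ B := fun y hy => hmax hy
  suffices hBle : B ≤ 2 * ((2 ^ k + 1) ^ M + c * N) * Ω (b - a) from
    fun y hy => (hB y hy).trans hBle
  set j := ⌊(y₀ - a) / τ⌋₊ with hj
  have hj1 : (j : ℝ) * τ ≤ y₀ - a := by
    rw [← le_div_iff₀ hτ0]
    exact Nat.floor_le (div_nonneg (sub_nonneg.mpr hy₀.1) hτ0.le)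
  have hj2 : y₀ - a < (j + 1) * τ := by
    rw [← div_lt_iff₀ hτ0]
    exact Nat.lt_floor_add_one _
  have hjM : j ≤ M := by
    have : (j : ℝ) * τ ≤ M * τ := by rw [hMτ]; linarith [hy₀.2]
    exact_mod_cast le_of_mul_le_mul_right this hτ0
  have hjτ : 0 ≤ (j : ℝ) * τ := by positivity
  have hmemj : a + j * τ ∈ Set.Icc a b := ⟨by linarith, by linarith [hy₀.2]⟩
  have hgrid := h.abs_sub_gridInterp_le hΩ (by omega) (x := a) (v := τ) (M := M) (j := j)
    ⟨le_rfl, hab.le⟩ (by rw [hMτ]; exact ⟨by linarith, by linarith⟩) hjM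
  rw [← hPeval, abs_of_pos hτ0] at hgrid
  have hM1 : (1 : ℝ) ≤ M := (one_le_pow₀ (by norm_num)).trans hM2
  have hgrid' : |g (a + j * τ) - P.eval (a + j * τ)| ≤ (2 ^ k + 1) ^ M * Ω (b - a) := by
    refine hgrid.trans (mul_le_mul (pow_le_pow_right₀ ?_ hjM) (hmono ?_) (hΩ _) (by positivity))
    · linarith [show (0 : ℝ) ≤ 2 ^ k by positivity]
    · rw [← hMτ]; exact le_mul_of_one_le_left hτ0.le hM1
  have hmar := hc _ Ω a b B (h.sub_polynomial hPdeg) hΩ hmono hB N τ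
    (by rw [← hMτ, hcast]; linarith) y₀ hy₀ (a + j * τ) hmemj
    (by rw [abs_le]; constructor <;> linarith)
  have hsum : ∑ n ∈ Finset.range N, Ω (2 ^ n * τ) / 2 ^ n ≤ N * Ω (b - a) := by
    rw [← nsmul_eq_mul]
    conv_rhs => rw [← Finset.card_range N]
    refine Finset.sum_le_card_nsmul _ _ _ fun n hn => ?_
    refine (div_le_self (hΩ _) (one_le_pow₀ (by norm_num))).trans (hmono ?_)
    rw [← hMτ]
    refine mul_le_mul_of_nonneg_right (le_trans ?_ hM2) hτ0.le
    exact pow_le_pow_right₀ (by norm_num) (Finset.mem_range.mp hn).le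
  have hhalf : c * (B / 2 ^ N) ≤ B / 2 := by
    rw [mul_div_assoc', div_le_iff₀ h2N]
    nlinarith [abs_nonneg (g y₀ - P.eval y₀)]
  have htri : B ≤ |g (a + j * τ) - P.eval (a + j * τ)| +
      |g y₀ - P.eval y₀ - (g (a + j * τ) - P.eval (a + j * τ))| := by
    rw [hBdef]
    calc _ = |(g (a + j * τ) - P.eval (a + j * τ)) +
        (g y₀ - P.eval y₀ - (g (a + j * τ) - P.eval (a + j * τ)))| := by congr 1; ring
      _ ≤ _ := abs_add_le _ _
  have hcs := mul_le_mul_of_nonneg_left hsum hc0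
  rw [mul_add] at hmar
  linarith

section Integral

variable {Ω : ℝ → ℝ}

theorem intervalIntegrable_div_sq (hmono : Monotone Ω) {p q : ℝ} (hp : 0 < p) (hpq : p ≤ q) :
    IntervalIntegrable (fun u => Ω u / u ^ 2) MeasureTheory.volume p q := by
  simp only [div_eq_mul_inv]
  refine hmono.intervalIntegrable.mul_continuousOn ?_
  refine ContinuousOn.inv₀ (by fun_prop) fun u hu => ?_
  rw [Set.uIcc_of_le hpq] at hu
  exact pow_ne_zero _ (hp.trans_le hu.1).ne'

theorem div_le_integral_doubling (hmono : Monotone Ω) (hΩ : ∀ t, 0 ≤ Ω t) {p : ℝ} (hp : 0 < p) :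
    Ω p / p ≤ 4 * ∫ u in p..(2 * p), Ω u / u ^ 2 := by
  have h := intervalIntegral.integral_mono_on (a := p) (b := 2 * p) (μ := MeasureTheory.volume)
    (f := fun _ => Ω p / (2 * p) ^ 2) (g := fun u => Ω u / u ^ 2) (by linarith)
    intervalIntegrable_const (intervalIntegrable_div_sq hmono hp (by linarith)) fun u hu => by
      have hu0 : 0 < u := hp.trans_le hu.1
      exact div_le_div₀ (hΩ u) (hmono hu.1) (by positivity) (pow_le_pow_left₀ hu0.le hu.2 2)
  rw [intervalIntegral.integral_const, smul_eq_mul] at h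
  calc Ω p / p = 4 * ((2 * p - p) * (Ω p / (2 * p) ^ 2)) := by field_simp; ring
    _ ≤ _ := by linarith

theorem integral_div_sq_mono (hmono : Monotone Ω) (hΩ : ∀ t, 0 ≤ Ω t) {p q p' q' : ℝ}
    (hp : 0 < p) (hpp : p ≤ p') (hpq : p' ≤ q') (hqq : q' ≤ q) :
    ∫ u in p'..q', Ω u / u ^ 2 ≤ ∫ u in p..q, Ω u / u ^ 2 :=
  intervalIntegral.integral_mono_interval hpp hpq hqq
    (Filter.Eventually.of_forall fun u => div_nonneg (hΩ u) (sq_nonneg u))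
    (intervalIntegrable_div_sq hmono hp (hpp.trans (hpq.trans hqq)))

theorem sum_le_integral_div_sq (hmono : Monotone Ω) (hΩ : ∀ t, 0 ≤ Ω t) {τ : ℝ} (hτ : 0 < τ)
    (N : ℕ) :
    ∑ n ∈ Finset.range N, Ω (2 ^ n * τ) / 2 ^ n ≤
      4 * τ * ∫ u in τ..(2 ^ N * τ), Ω u / u ^ 2 := by
  induction N with
  | zero => simp
  | succ N ih =>
    have hp : 0 < 2 ^ N * τ := by positivity
    have h1 : (1 : ℝ) ≤ 2 ^ N := one_le_pow₀ (by norm_num)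
    have h2 : 2 * (2 ^ N * τ) = 2 ^ (N + 1) * τ := by ring
    have hstep := div_le_integral_doubling hmono hΩ hp
    rw [h2] at hstep
    rw [Finset.sum_range_succ, ← intervalIntegral.integral_add_adjacent_intervals
      (intervalIntegrable_div_sq hmono hτ (le_mul_of_one_le_left hτ.le h1))
      (intervalIntegrable_div_sq hmono hp (by rw [← h2]; linarith))]
    have h3 : Ω (2 ^ N * τ) / 2 ^ N = τ * (Ω (2 ^ N * τ) / (2 ^ N * τ)) := by field_simp
    rw [h3]
    nlinarith [mul_le_mul_of_nonneg_left hstep hτ.le]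

end Integral

/-- A polynomial of degree less than `k` may be subtracted from `g` so that the remainder and its
oscillation on the scale `δ` are controlled by the integral of the modulus of smoothness. -/
theorem exists_polynomial_oscillation_le (k : ℕ) (hk : 2 ≤ k) :
    ∃ c : ℝ, 0 ≤ c ∧ ∀ (g Ω : ℝ → ℝ) (a b : ℝ), a < b → ContinuousOn g (Set.Icc a b) →
      DiffBound k Ω g a b → (∀ t, 0 ≤ Ω t) → Monotone Ω → ∀ δ : ℝ, 0 < δ → δ ≤ b - a →
      ∃ P : ℝ[X], P.degree < k ∧
        (∀ y ∈ Set.Icc a b, |g y - P.eval y| ≤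
          c * ((b - a) * ∫ u in δ..(2 * (b - a)), Ω u / u ^ 2)) ∧
        ∀ ξ ∈ Set.Icc a b, ∀ η ∈ Set.Icc a b, |ξ - η| ≤ 2 * δ →
          |(g ξ - P.eval ξ) - (g η - P.eval η)| ≤
            c * (δ * ∫ u in δ..(2 * (b - a)), Ω u / u ^ 2) := by
  obtain ⟨c₁, hc₁0, hc₁⟩ := exists_marchaud k hk
  obtain ⟨c₂, hc₂0, hc₂⟩ := exists_whitney k hk
  have hk1 : (1 : ℝ) ≤ k - 1 := by
    have : (2 : ℝ) ≤ k := by exact_mod_cast hk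
    linarith
  set κ : ℝ := k - 1 with hκ
  refine ⟨c₁ * (8 + 32 * κ * c₂) + 32 * κ * c₂, by positivity, ?_⟩
  intro g Ω a b hab hg h hΩ hmono δ hδ hδh
  obtain ⟨P, hPdeg, hP⟩ := hc₂ g Ω a b hab hg h hΩ hmono
  have hh : 0 < b - a := sub_pos.mpr hab
  set J := ∫ u in δ..(2 * (b - a)), Ω u / u ^ 2 with hJ
  have hΩJ : Ω (b - a) ≤ 4 * ((b - a) * J) := by
    have h1 := div_le_integral_doubling hmono hΩ hh
    have h2 := integral_div_sq_mono hmono hΩ hδ hδh (by linarith : b - a ≤ 2 * (b - a)) le_rfl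
    rw [div_le_iff₀ hh] at h1
    calc _ ≤ _ := h1
      _ ≤ 4 * J * (b - a) := by gcongr
      _ = _ := by ring
  have hJ0 : 0 ≤ J := by
    have := hΩ (b - a)
    by_contra hneg
    nlinarith [mul_pos hh (neg_pos.mpr (not_le.mp hneg))]
  set B := c₂ * Ω (b - a) with hB
  have hB0 : 0 ≤ B := mul_nonneg hc₂0 (hΩ _)
  have hBJ : B ≤ 4 * c₂ * ((b - a) * J) := by
    calc B ≤ c₂ * (4 * ((b - a) * J)) := mul_le_mul_of_nonneg_left hΩJ hc₂0
      _ = _ := by ring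
  have hhJ : 0 ≤ (b - a) * J := by positivity
  have hκc : 0 ≤ κ * c₂ := by positivity
  refine ⟨P, hPdeg, fun y hy => (hP y hy).trans (hBJ.trans ?_), ?_⟩
  · refine mul_le_mul_of_nonneg_right ?_ hhJ
    have h1 : 0 ≤ c₁ * (8 + 32 * κ * c₂) := by positivity
    nlinarith [mul_le_mul_of_nonneg_right hk1 hc₂0]
  · intro ξ hξ η hη hd
    rcases le_or_gt (4 * κ * δ) (b - a) with hsmall | hlarge
    · obtain ⟨N, hN1, hN2⟩ := exists_nat_pow_near (x := (b - a) / (4 * κ * δ)) (y := 2)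
        ((one_le_div (by positivity)).mpr hsmall) one_lt_two
      rw [le_div_iff₀ (by positivity)] at hN1
      rw [div_lt_iff₀ (by positivity)] at hN2
      have hmar := hc₁ _ Ω a b B (h.sub_polynomial (natDegree_lt_of_degree_lt' (by omega) hPdeg))
        hΩ hmono hP N (2 * δ) (by linarith) ξ hξ η hη hd
      refine hmar.trans ?_
      have h2N : (1 : ℝ) ≤ 2 ^ N := one_le_pow₀ (by norm_num)
      have hsum := sum_le_integral_div_sq hmono hΩ (show 0 < 2 * δ by positivity) N
      have hint := integral_div_sq_mono hmono hΩ hδ (by linarith : δ ≤ 2 * δ)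
        (le_mul_of_one_le_left (by positivity) h2N)
        (show 2 ^ N * (2 * δ) ≤ 2 * (b - a) by
          have : 2 ^ N * δ ≤ 2 ^ N * (4 * κ * δ) := by
            gcongr
            nlinarith
          linarith)
      have hs : ∑ n ∈ Finset.range N, Ω (2 ^ n * (2 * δ)) / 2 ^ n ≤ 8 * (δ * J) :=
        hsum.trans (by nlinarith [mul_le_mul_of_nonneg_left hint hδ.le])
      have hb : B / 2 ^ N ≤ 32 * κ * c₂ * (δ * J) := by
        rw [div_le_iff₀ (by positivity)]
        calc B ≤ 4 * c₂ * ((b - a) * J) := hBJ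
          _ ≤ 4 * c₂ * ((2 ^ (N + 1) * (4 * κ * δ)) * J) := by gcongr
          _ = _ := by ring
      calc _ ≤ c₁ * (8 * (δ * J) + 32 * κ * c₂ * (δ * J)) := by gcongr
        _ ≤ _ := by
          have : 0 ≤ κ * c₂ * (δ * J) := by positivity
          nlinarith
    · calc |(g ξ - P.eval ξ) - (g η - P.eval η)| ≤ B + B :=
            (abs_sub _ _).trans (add_le_add (hP ξ hξ) (hP η hη))
        _ ≤ 8 * c₂ * ((b - a) * J) := by linarith
        _ ≤ 8 * c₂ * ((4 * κ * δ) * J) := by gcongr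
        _ ≤ _ := by
          have : 0 ≤ c₁ * (8 + 32 * κ * c₂) * (δ * J) := by positivity
          nlinarith

section Modulus

variable {k : ℕ} {g : ℝ → ℝ} {a b : ℝ}

theorem modulus_nonneg (t : ℝ) : 0 ≤ modulus k g t a b := by
  apply Real.sSup_nonneg
  rintro y ⟨u, x, -, -, -, rfl⟩
  exact abs_nonneg _

theorem bddAbove_abs_centralDiff (hg : ContinuousOn g (Set.Icc a b)) (t : ℝ) :
    BddAbove {y : ℝ | ∃ u x : ℝ, 0 < u ∧ u ≤ t ∧ x ∈ Set.Icc a b ∧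
      y = |centralDiff k u g x a b|} := by
  obtain ⟨B, hB⟩ := isCompact_Icc.exists_bound_of_continuousOn hg
  refine ⟨∑ i ∈ Finset.range (k + 1), (k.choose i : ℝ) * B, ?_⟩
  rintro y ⟨u, x, hu, -, hx, rfl⟩
  have hB0 : 0 ≤ B := (norm_nonneg _).trans (hB x hx)
  unfold centralDiff
  split_ifs with hmem
  · refine (Finset.abs_sum_le_sum_abs _ _).trans (Finset.sum_le_sum fun i hi => ?_)
    rw [abs_mul, abs_mul, abs_pow, abs_neg, abs_one, one_pow, one_mul, Nat.abs_cast]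
    refine mul_le_mul_of_nonneg_left (hB _ ?_) (Nat.cast_nonneg _)
    have hi' : (i : ℝ) ≤ k := by exact_mod_cast Nat.lt_succ_iff.mp (Finset.mem_range.mp hi)
    have h1 := mul_le_mul_of_nonneg_right hi' hu.le
    have h2 : 0 ≤ (i : ℝ) * u := by positivity
    constructor <;> nlinarith [hmem.1.1, hmem.2.2]
  · rw [abs_zero]
    exact Finset.sum_nonneg fun i _ => mul_nonneg (Nat.cast_nonneg _) hB0

theorem monotone_modulus (hg : ContinuousOn g (Set.Icc a b)) :
    Monotone fun t => modulus k g t a b := by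
  intro t t' htt
  refine Real.sSup_le ?_ (modulus_nonneg t')
  rintro y ⟨u, x, hu, hut, hx, rfl⟩
  exact le_csSup (bddAbove_abs_centralDiff hg t') ⟨u, x, hu, hut.trans htt, hx, rfl⟩

theorem diffBound_modulus (hk : 0 < k) (hg : ContinuousOn g (Set.Icc a b)) :
    DiffBound k (fun t => modulus k g t a b) g a b := by
  intro x v hx hv
  have hmid : x + (k / 2 : ℝ) * v ∈ Set.Icc a b :=
    add_mul_mem_Icc hx hv (by positivity) (half_le_self (Nat.cast_nonneg k))
  rcases lt_trichotomy v 0 with hv0 | rfl | hv0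
  · refine le_csSup (bddAbove_abs_centralDiff hg _)
      ⟨-v, x + (k / 2 : ℝ) * v, by linarith, (abs_of_neg hv0).ge, hmid, ?_⟩
    have e1 : x + (k / 2 : ℝ) * v - (k / 2 : ℝ) * -v = x + k * v := by ring
    have e2 : x + (k / 2 : ℝ) * v + (k / 2 : ℝ) * -v = x := by ring
    rw [centralDiff, e1, e2, if_pos ⟨hv, hx⟩]
    suffices hs : (fwdDiff v)^[k] g x = (-1) ^ k * ∑ i ∈ Finset.range (k + 1),
        (-1) ^ i * (k.choose i : ℝ) * g (x + (k / 2 : ℝ) * v + ((k / 2 : ℝ) - i) * -v) by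
      rw [hs, abs_mul, abs_pow, abs_neg, abs_one, one_pow, one_mul]
    rw [fwdDiff_iter_eq_sum_shift, Finset.mul_sum]
    refine Finset.sum_congr rfl fun i hi => ?_
    obtain ⟨d, hd⟩ := Nat.exists_eq_add_of_le (Nat.lt_succ_iff.mp (Finset.mem_range.mp hi))
    have e3 : x + (k / 2 : ℝ) * v + ((k / 2 : ℝ) - i) * -v = x + i * v := by ring
    have e4 : ((-1 : ℝ)) ^ (k - i) = (-1) ^ k * (-1) ^ i := by
      rw [hd, Nat.add_sub_cancel_left, pow_add, mul_right_comm, ← mul_pow]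
      simp
    rw [e3, zsmul_eq_mul, nsmul_eq_mul]
    push_cast
    rw [e4]
    ring
  · obtain ⟨k, rfl⟩ := Nat.exists_eq_add_one.mpr hk
    rw [Function.iterate_succ_apply', fwdDiff, add_zero, sub_self, abs_zero]
    exact modulus_nonneg _
  · refine le_csSup (bddAbove_abs_centralDiff hg _)
      ⟨v, x + (k / 2 : ℝ) * v, hv0, (abs_of_pos hv0).ge, hmid, ?_⟩
    have e1 : x + (k / 2 : ℝ) * v - (k / 2 : ℝ) * v = x := by ring
    have e2 : x + (k / 2 : ℝ) * v + (k / 2 : ℝ) * v = x + k * v := by ring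
    rw [centralDiff, e1, e2, if_pos ⟨hx, hv⟩, fwdDiff_iter_eq_sum_shift,
      ← Finset.sum_range_reflect]
    congr 1
    refine Finset.sum_congr rfl fun i hi => ?_
    have hik : i ≤ k := Nat.lt_succ_iff.mp (Finset.mem_range.mp hi)
    rw [show k + 1 - 1 - i = k - i by omega, Nat.sub_sub_self hik, Nat.choose_symm hik,
      zsmul_eq_mul, nsmul_eq_mul, Nat.cast_sub hik]
    push_cast
    congr 2
    ring

end Modulus

theorem exists_derivative_eq {k : ℕ} {P : ℝ[X]} (hP : P.degree < k) :
    ∃ R : ℝ[X], derivative R = P ∧ R.degree < (k + 1 : ℕ) := by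
  rcases Nat.eq_zero_or_pos k with rfl | hk
  · refine ⟨0, ?_, by simp⟩
    have : P = 0 := by simpa using hP
    rw [this, derivative_zero]
  refine ⟨∑ n ∈ Finset.range k, C (P.coeff n / (n + 1)) * X ^ (n + 1), ?_, ?_⟩
  · conv_rhs => rw [P.as_sum_range_C_mul_X_pow' (natDegree_lt_of_degree_lt' hk hP)]
    rw [derivative_sum]
    refine Finset.sum_congr rfl fun n _ => ?_
    have : (n : ℝ) + 1 ≠ 0 := by positivity
    rw [derivative_C_mul_X_pow]
    congr 2
    push_cast
    field_simp
  · rw [← mem_degreeLT]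
    refine Submodule.sum_mem _ fun n hn => mem_degreeLT.mpr ?_
    refine lt_of_le_of_lt (degree_C_mul_X_pow_le _ _) ?_
    exact_mod_cast Nat.succ_lt_succ (Finset.mem_range.mp hn)

theorem exists_iterate_derivative_eq {k : ℕ} {P : ℝ[X]} (hP : P.degree < k) (r : ℕ) :
    ∃ R : ℝ[X], derivative^[r] R = P ∧ R.degree < (k + r : ℕ) := by
  induction r with
  | zero => exact ⟨P, rfl, hP⟩
  | succ r ih =>
    obtain ⟨R, hR, hdeg⟩ := ih
    obtain ⟨S, hS, hdeg'⟩ := exists_derivative_eq hdeg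
    exact ⟨S, by rw [Function.iterate_succ_apply, hS, hR], hdeg'⟩

section Subtraction

variable {f : ℝ → ℝ} {x : ℕ → ℝ} {m r : ℕ} {a b lam : ℝ}

theorem iteratedDerivWithin_sub_polynomial (hab : a < b) (hf : ContDiffOn ℝ r f (Set.Icc a b))
    (R : ℝ[X]) {e : ℕ} (he : e ≤ r) {y : ℝ} (hy : y ∈ Set.Icc a b) :
    iteratedDerivWithin e (fun y => f y - R.eval y) (Set.Icc a b) y =
      iteratedDerivWithin e f (Set.Icc a b) y - (derivative^[e] R).eval y := by
  induction e generalizing y with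
  | zero => simp
  | succ e ih =>
    rw [iteratedDerivWithin_succ, derivWithin_congr (fun z hz => ih (by omega) hz)
      (ih (by omega) hy)]
    exact (hasDerivWithinAt_sub_polynomial hab hf le_rfl R (by omega) hy).derivWithin
      (uniqueDiffOn_Icc hab y hy)

/-- A knot is repeated at most `r + 1` times. -/
theorem count_blockKnots_le (hlam : 0 < lam) (hab : a < b) (hx : MonotoneOn x (Set.Iio m))
    (hsep : ∀ j, j + r + 1 < m → lam * (b - a) ≤ x (j + r + 1) - x j) (p : ℝ) :
    (blockKnots x m 0).count p ≤ r + 1 := by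
  classical
  have h : (blockKnots x m 0).count p =
      ((Finset.range m).filter fun i => p = x i).card := by
    simp [blockKnots, Multiset.count_map, Finset.card, Finset.filter]
  rw [h]
  set S := (Finset.range m).filter fun i => p = x i with hS
  rcases S.eq_empty_or_nonempty with h0 | h0
  · simp [h0]
  have hmin := S.min'_mem h0
  set j := S.min' h0
  have hsub : S ⊆ Finset.Ico j (j + (r + 1)) := by
    intro l hl
    refine Finset.mem_Ico.mpr ⟨S.min'_le l hl, ?_⟩
    by_contra hge
    rw [hS, Finset.mem_filter, Finset.mem_range] at hl hmin
    have h1 := hsep j (by omega)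
    have h2 : x (j + r + 1) ≤ x l :=
      hx (by simp; omega) (by simpa using hl.1) (by omega)
    have h3 := mul_pos hlam (sub_pos.mpr hab)
    linarith [hl.2, hmin.2]
  simpa using Finset.card_le_card hsub

/-- Hermite interpolation reproduces polynomials of degree less than `m`. -/
theorem hermitePoly_sub_polynomial (hab : a < b) (hf : ContDiffOn ℝ r f (Set.Icc a b))
    (hlam : 0 < lam) (hx : MonotoneOn x (Set.Iio m)) (hmem : ∀ l < m, x l ∈ Set.Icc a b)
    (hsep : ∀ j, j + r + 1 < m → lam * (b - a) ≤ x (j + r + 1) - x j)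
    {R : ℝ[X]} (hR : R.degree < m) :
    hermitePoly (fun y => f y - R.eval y) (Set.Icc a b) x m =
      hermitePoly f (Set.Icc a b) x m - R := by
  rw [hermitePoly_eq_newtonPoly, hermitePoly_eq_newtonPoly, ← sub_eq_zero]
  refine eq_zero_of_iterate_derivative_eval (M := blockKnots x m 0) ?_ fun p e he => ?_
  · rw [card_blockKnots]
    refine lt_of_le_of_lt (degree_sub_le _ _) (max_lt degree_newtonPoly_lt ?_)
    exact lt_of_le_of_lt (degree_sub_le _ _) (max_lt degree_newtonPoly_lt hR)
  · have hp : p ∈ Set.Icc a b := by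
      obtain ⟨l, hl, rfl⟩ := mem_blockKnots.mp (Multiset.count_pos.mp ((Nat.zero_le e).trans_lt he))
      exact hmem _ (by omega)
    have her : e ≤ r := by
      have := count_blockKnots_le hlam hab hx hsep p
      omega
    rw [iterate_derivative_sub, iterate_derivative_sub, eval_sub, eval_sub,
      iterate_derivative_newtonPoly_eval hx (by omega) he,
      iterate_derivative_newtonPoly_eval hx (by omega) he,
      iteratedDerivWithin_sub_polynomial hab hf R her hp, sub_self]

end Subtraction

/-- The Hermite polynomial takes the value of `f` at each knot. -/
theorem eval_hermitePoly_knot {f : ℝ → ℝ} {s : Set ℝ} {x : ℕ → ℝ} {m l : ℕ}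
    (hx : MonotoneOn x (Set.Iio m)) (hl : l < m) : (hermitePoly f s x m).eval (x l) = f (x l) := by
  have hc : 0 < (blockKnots x m 0).count (x l) :=
    Multiset.count_pos.mpr (mem_blockKnots.mpr ⟨l, hl, by rw [zero_add]⟩)
  have := iterate_derivative_newtonPoly_eval (f := f) (s := s) hx (by omega) hc
  rwa [Function.iterate_zero, id_eq, iteratedDerivWithin_zero, ← hermitePoly_eq_newtonPoly] at this

/-- The error estimate for a fixed order `r`. -/
theorem exists_abs_sub_hermitePoly_le (m r : ℕ) (hr : r + 2 ≤ m) (lam : ℝ) (hlam : 0 < lam)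
    (hlam1 : lam ≤ 1) :
    ∃ c : ℝ, 0 ≤ c ∧ ∀ (x : ℕ → ℝ) (a b : ℝ), a < b → MonotoneOn x (Set.Iio m) →
      (∀ l < m, x l ∈ Set.Icc a b) →
      (∀ j, j + r + 1 < m → lam * (b - a) ≤ x (j + r + 1) - x j) →
      ∀ f : ℝ → ℝ, ContDiffOn ℝ r f (Set.Icc a b) → ∀ t ∈ Set.Icc a b, ∀ σ : ℕ → ℕ,
        IsDistanceOrder σ x m t →
        |f t - (hermitePoly f (Set.Icc a b) x m).eval t| ≤
          c * distProd σ x r t * ∫ u in |t - x (σ r)|..(2 * (b - a)),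
            modulus (m - r) (iteratedDerivWithin r f (Set.Icc a b)) u a b / u ^ 2 := by
  obtain ⟨c, hc0, hc⟩ := exists_polynomial_oscillation_le (m - r) (by omega)
  refine ⟨c * (1 + m * (2 / lam) ^ m), by positivity, ?_⟩
  intro x a b hab hx hmem hsep f hf t ht σ hσ
  have hh : 0 < b - a := sub_pos.mpr hab
  set g := iteratedDerivWithin r f (Set.Icc a b) with hg
  have hgc : ContinuousOn g (Set.Icc a b) :=
    hf.continuousOn_iteratedDerivWithin le_rfl (uniqueDiffOn_Icc hab)
  have hσr : σ r < m := hσ.1.mapsTo (Set.mem_Iio.mpr (by omega))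
  have hδh : |t - x (σ r)| ≤ b - a := by
    have := hmem _ hσr
    rw [abs_le]
    constructor <;> linarith [this.1, this.2, ht.1, ht.2]
  by_cases hknot : ∃ l < m, x l = t
  · obtain ⟨l, hl, rfl⟩ := hknot
    rw [eval_hermitePoly_knot hx hl, sub_self, abs_zero]
    refine mul_nonneg (mul_nonneg (by positivity) (Finset.prod_nonneg fun _ _ => abs_nonneg _)) ?_
    exact intervalIntegral.integral_nonneg (by linarith) fun u _ =>
      div_nonneg (modulus_nonneg u) (sq_nonneg u)
  · push Not at hknot
    have hδ : 0 < |t - x (σ r)| := abs_pos.mpr (sub_ne_zero.mpr (hknot _ hσr).symm)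
    obtain ⟨P, hPdeg, hPK, hPW⟩ := hc g (fun u => modulus (m - r) g u a b) a b hab hgc
      (diffBound_modulus (by omega) hgc) modulus_nonneg (monotone_modulus hgc) _ hδ hδh
    set J := ∫ u in |t - x (σ r)|..(2 * (b - a)), modulus (m - r) g u a b / u ^ 2
    obtain ⟨R, hR, hRdeg⟩ := exists_iterate_derivative_eq hPdeg r
    rw [Nat.sub_add_cancel (by omega)] at hRdeg
    have hder : ∀ y ∈ Set.Icc a b,
        iteratedDerivWithin r (fun y => f y - R.eval y) (Set.Icc a b) y = g y - P.eval y :=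
      fun y hy => by rw [iteratedDerivWithin_sub_polynomial hab hf R le_rfl hy, hR]
    have hmain := abs_sub_hermitePoly_le (f := fun y => f y - R.eval y) hab
      (hf.sub (by simpa using (R.contDiff_aeval (𝕜 := ℝ) r).contDiffOn)) (by omega) hx hmem hlam hlam1 hsep
      (fun y hy => by rw [hder y hy]; exact hPK y hy) ht hknot hσ
      (fun ξ hξ η hη hd => by rw [hder ξ hξ, hder η hη]; exact hPW ξ hξ η hη hd)
    rw [hermitePoly_sub_polynomial hab hf hlam hx hmem hsep hRdeg, eval_sub,
      sub_sub_sub_cancel_right] at hmain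
    refine hmain.trans_eq ?_
    rw [distProd, Finset.prod_range_succ]
    field_simp

end HermiteApprox

theorem theorem3 (m : ℕ) (lam : ℝ) (hlam : 0 < lam) (hlam1 : lam ≤ 1) :
    ∃ C : ℝ, 0 < C ∧
      ∀ (r : ℕ) (_ : r + 2 ≤ m)
        (x : ℕ → ℝ) (_ : ∀ j : ℕ, j + 1 < m → x j ≤ x (j + 1))
        (_ : x 0 < x (m - 1))
        (_ : ∀ j : ℕ, j + r + 1 < m → lam * (x (m - 1) - x 0) ≤ x (j + r + 1) - x j)
        (f : ℝ → ℝ) (_ : ContDiffOn ℝ r f (Set.Icc (x 0) (x (m - 1)))),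
        HermiteApprox.IsHermiteInterpolant
            (HermiteApprox.hermitePoly f (Set.Icc (x 0) (x (m - 1))) x m)
            f (Set.Icc (x 0) (x (m - 1))) x m ∧
        ∀ t ∈ Set.Icc (x 0) (x (m - 1)),
          ∀ σ : ℕ → ℕ, HermiteApprox.IsDistanceOrder σ x m t →
            |f t - (HermiteApprox.hermitePoly f (Set.Icc (x 0) (x (m - 1))) x m).eval t| ≤
              C * HermiteApprox.distProd σ x r t *
                ∫ u in |t - x (σ r)|..(2 * (x (m - 1) - x 0)),
                  HermiteApprox.modulus (m - r)
                    (iteratedDerivWithin r f (Set.Icc (x 0) (x (m - 1)))) u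
                    (x 0) (x (m - 1)) / u ^ 2 := by
  choose! c hc0 hc using fun (r : ℕ) (hr : r + 2 ≤ m) =>
    HermiteApprox.exists_abs_sub_hermitePoly_le m r hr lam hlam hlam1
  refine ⟨1 + ∑ r ∈ Finset.range m, |c r|, by positivity, ?_⟩
  intro r hr x hstep hlt hsep f hf
  have hmono : MonotoneOn x (Set.Iio m) := by
    intro i hi j hj hij
    rw [Set.mem_Iio] at hj
    induction j, hij using Nat.le_induction with
    | base => exact le_rfl
    | succ j _ ih => exact (ih (by omega)).trans (hstep j hj)
  have hmem : ∀ l < m, x l ∈ Set.Icc (x 0) (x (m - 1)) := fun l hl =>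
    ⟨hmono (by simp; omega) hl (Nat.zero_le l),
      hmono hl (by simp; omega) (by omega)⟩
  refine ⟨HermiteApprox.isHermiteInterpolant_hermitePoly hmono, fun t ht σ hσ => ?_⟩
  refine (hc r hr x _ _ hlt hmono hmem hsep f hf t ht σ hσ).trans ?_
  have hcr : c r ≤ 1 + ∑ r ∈ Finset.range m, |c r| := by
    have := Finset.single_le_sum (f := fun r => |c r|) (fun i _ => abs_nonneg (c i))
      (Finset.mem_range.mpr (show r < m by omega))
    linarith [le_abs_self (c r)]
  have hσr := hmem _ (hσ.1.mapsTo (Set.mem_Iio.mpr (show r < m by omega)))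
  have hδ : |t - x (σ r)| ≤ 2 * (x (m - 1) - x 0) := by
    rw [abs_le]
    constructor <;> linarith [ht.1, ht.2, hσr.1, hσr.2]
  refine mul_le_mul_of_nonneg_right (mul_le_mul_of_nonneg_right hcr
    (Finset.prod_nonneg fun _ _ => abs_nonneg _)) ?_
  exact intervalIntegral.integral_nonneg hδ fun u _ =>
    div_nonneg (HermiteApprox.modulus_nonneg u) (sq_nonneg u)
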